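/- For a permutation $\alpha\in S_n$ of $\{1,\dots,n\}$ let $z(\alpha)$ be its number of cycles (fixed points included), let $\zeta_n=(1,2,\dots,n)$, and define the genus $g(\alpha)$ by $n+1-2g(\alpha)=z(\alpha)+z(\alpha^{-1}\zeta_n)$, where products are composed right to left. A back point of $\alpha$ is an element $i$ with $\alpha(i)<i$ such that $\alpha(i)$ is not the smallest element of its cycle. A trivial cycle of $\alpha$ is a cycle of the form $(i,i+1,\dots,i+p)$ with sums taken modulo $n$ (fixed points included), and $\alpha$ is reduced if it has no trivial cycle. For $n,k\ge 0$ let $r_*(n,k)$ be the number of reduced permutations of genus one in $S_n$ with exactly $k$ cycles, and for $j=0,1,2$ let $r_j(n,k)$ be the number of those that have exactly $j$ back points. Then for all $n,k\ge 0$ $$r_*(n,k)=\binom{n+2}{2k+2}\binom{k+1}{3}+\binom{n+1}{2k+2}\binom{k+1}{2},$$ $$r_0(n,k)=\binom{n}{2k}\binom{k+1}{3},\qquad r_1(n,k)=\binom{n}{2k+1}\left(\binom{k+2}{3}+\binom{k+1}{3}\right),\qquad r_2(n,k)=\binom{n}{2k+2}\binom{k+2}{3}.$$ Moreover, the formal power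 series $R_*(x,y)=\sum_{n,k\ge0}r_*(n,k)x^ny^k$ and $R_j(x,y)=\sum_{n,k\ge0}r_j(n,k)x^ny^k$ satisfy $$R_*(x,y)=\frac{yx^3(1-x)^2(1-x+xy)}{((1-x)^2-yx^2)^4},\qquad R_0(x,y)=\frac{y^2x^4(1-x)^3}{((1-x)^2-yx^2)^4},$$ $$R_1(x,y)=\frac{yx^3(1-x)^2((1-x)^2+yx^2)}{((1-x)^2-yx^2)^4},\qquad R_2(x,y)=\frac{yx^4(1-x)^3}{((1-x)^2-yx^2)^4}.$$ -/

import Mathlib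

/-!
Permutations of `{1, …, n}` are elements of `Equiv.Perm (Fin n)`, the point `i + 1` of `{1, …, n}`
being `i : Fin n`. This shift preserves the linear and the circular order, which is all that the
notions below use. Products are composed right to left.
-/

namespace GenusOne

/-- The circular permutation `ζ_n = (1, 2, …, n)`, that is `i ↦ i + 1` modulo `n`. -/
def zeta (n : ℕ) : Equiv.Perm (Fin n) := finRotate n

/-- `z(α)`: the number of cycles of `α`, fixed points included. -/
noncomputable def numCycles {n : ℕ} (α : Equiv.Perm (Fin n)) : ℕ :=
  Nat.card (Quotient (Equiv.Perm.SameCycle.setoid α))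

/-- `α` has genus `g`, where the genus is defined by `n + 1 - 2 g = z(α) + z(α⁻¹ ζ_n)`. -/
def HasGenus {n : ℕ} (α : Equiv.Perm (Fin n)) (g : ℕ) : Prop :=
  n + 1 = numCycles α + numCycles (α⁻¹ * zeta n) + 2 * g

/-- `i` is a back point of `α`: `α(i) < i` and `α(i)` is not the smallest element of its cycle. -/
def IsBackPoint {n : ℕ} (α : Equiv.Perm (Fin n)) (i : Fin n) : Prop :=
  α i < i ∧ ∃ j, α.SameCycle (α i) j ∧ j < α i

/-- The number of back points of `α`. -/
noncomputable def numBackPoints {n : ℕ} (α : Equiv.Perm (Fin n)) : ℕ :=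
  Set.ncard {i | IsBackPoint α i}

/-- `(i, i + 1, …, i + p)`, with sums modulo `n`, is a cycle of `α` (a trivial cycle);
`p = 0` is the case of a fixed point, and `p = n - 1` that of `α = ζ_n`. -/
def IsTrivialCycle {n : ℕ} (α : Equiv.Perm (Fin n)) (i : Fin n) (p : ℕ) : Prop :=
  p < n ∧ (∀ t < p, α ((zeta n ^ t) i) = (zeta n ^ (t + 1)) i) ∧ α ((zeta n ^ p) i) = i

/-- `α` is reduced: it has no trivial cycle. -/
def IsReduced {n : ℕ} (α : Equiv.Perm (Fin n)) : Prop :=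
  ∀ i p, ¬ IsTrivialCycle α i p

/-- `r_*(n, k)`: the number of reduced permutations of genus one in `S_n` with `k` cycles. -/
noncomputable def rStar (n k : ℕ) : ℕ :=
  Set.ncard {α : Equiv.Perm (Fin n) | IsReduced α ∧ HasGenus α 1 ∧ numCycles α = k}

/-- `r_j(n, k)`: the number of reduced permutations of genus one in `S_n` with `k` cycles and
`j` back points. -/
noncomputable def r (j n k : ℕ) : ℕ :=
  Set.ncard {α : Equiv.Perm (Fin n) |
    IsReduced α ∧ HasGenus α 1 ∧ numCycles α = k ∧ numBackPoints α = j}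

/-- The formal power series `∑ a(n, k) x ^ n y ^ k` in `ℚ⟦x, y⟧`, with `x` and `y` the variables
of index `0` and `1`. -/
noncomputable def genFun (a : ℕ → ℕ → ℕ) : MvPowerSeries (Fin 2) ℚ :=
  fun m => (a (m 0) (m 1) : ℚ)

/-- The variable `x`, marking points. -/
noncomputable def x : MvPowerSeries (Fin 2) ℚ := MvPowerSeries.X 0

/-- The variable `y`, marking cycles. -/
noncomputable def y : MvPowerSeries (Fin 2) ℚ := MvPowerSeries.X 1

end GenusOne
open GenusOne

/-! Write `β = α⁻¹ ζ` for the dual of `α`. A fixed point of `β` is a point where `α` agrees with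
`ζ`. Deleting these points and relabelling the remaining ones in order preserves the genus, the
cycles of `α` and its back points, and shrinks a trivial cycle to a fixed point. Reduced
permutations of genus one are therefore exactly the inflations of primitive ones, where neither `α`
nor `β` has a fixed point, and the set of `m` surviving points is arbitrary (`ncard_reduced`).
Counting the points with `α i ≤ i` for `α` and for `β` shows that their back points add up to `2` in
genus one, and that a primitive `α` on `m` points with `k` cycles has exactly `m - 2 k` back points.
Hence `r_j(n, k)` is `C(n, 2 k + j)` times the number of primitive permutations on `2 k + j` points
with `k` cycles, `j = 0, 1, 2` (`r_eq`).

These are counted as gluings of the sides of a `2 m`-gon into a torus without vertices of degree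
one. The vertex permutation has `m - 1` cycles on `2 m` points, all of length at least two, so the
longer cycles are one 4-cycle or two 3-cycles. Between consecutive points of the set `D` of these 4
or 6 points, the gluing reverses an interval onto another one of the same length. A finite check
shows that opposite intervals are matched. So `D` is invariant under the antipode and determines the
gluing, and every antipodal set of 4 or 6 points occurs (`ncard_isTorusGluing`).

For `j = 0` the permutation `α` is itself such a gluing of a `2 k`-gon, and the sets `D` number
`C(k, 2) + C(k, 3)`. For `j = 1`, the pair of `α` and `β` is a bipartite gluing of a `2 (2 k +
1)`-gon, that is, one exchanging even and odd sides. This forces all gaps of `D` to be odd and leads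
to triples of alternating parity. The case `j = 2` is dual to `j = 0`. The generating functions
follow from Pascal's rule. -/

namespace GenusOne

open Equiv Equiv.Perm Finset

set_option linter.unusedSectionVars false

/-! ### Cycle counts and cycle lengths -/

section CycleCount

variable {X Y : Type*}

/-- The number of cycles of a permutation of an arbitrary type, fixed points included. -/
noncomputable def cycleCount (π : Perm X) : ℕ := Nat.card (Quotient (SameCycle.setoid π))

/-- The length of the cycle through `x`. -/
noncomputable def orbSize (π : Perm X) (x : X) : ℕ := Set.ncard {y | π.SameCycle x y}

theorem numCycles_eq_cycleCount {n : ℕ} (α : Perm (Fin n)) : numCycles α = cycleCount α := rfl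

/-- The `l` points of a cycle of length `l` contribute `1 / l` each. This reduces comparisons of
cycle counts to bounds on the lengths of individual cycles. -/
theorem cycleCount_eq_sum [Fintype X] (π : Perm X) :
    (cycleCount π : ℚ) = ∑ x, (orbSize π x : ℚ)⁻¹ := by
  classical
  let s := SameCycle.setoid π
  have : Fintype (Quotient s) := Fintype.ofFinite _
  rw [← Finset.sum_fiberwise (s := Finset.univ) (g := fun x : X => (Quotient.mk s x))]
  have key : ∀ q : Quotient s,
      ∑ x ∈ Finset.univ.filter (fun x => Quotient.mk s x = q), (orbSize π x : ℚ)⁻¹ = 1 := by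
    intro q
    induction q using Quotient.inductionOn with
    | h a =>
      have h1 : ∀ x ∈ Finset.univ.filter (fun x => Quotient.mk s x = Quotient.mk s a),
          (orbSize π x : ℚ)⁻¹
            = ((Finset.univ.filter (fun x => Quotient.mk s x = Quotient.mk s a)).card : ℚ)⁻¹ := by
        intro x hx
        have hx' : π.SameCycle x a := Quotient.exact (Finset.mem_filter.1 hx).2
        congr 2
        unfold orbSize
        rw [← Set.ncard_coe_finset]
        congr 1
        ext y
        simp only [Set.mem_ofPred_eq, Finset.coe_filter, Finset.mem_univ, true_and]
        constructor
        · intro h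
          exact Quotient.sound (show π.SameCycle y a from h.symm.trans hx')
        · intro h
          have : π.SameCycle y a := Quotient.exact h
          exact hx'.trans this.symm
      rw [Finset.sum_congr rfl h1, Finset.sum_const, nsmul_eq_mul]
      apply mul_inv_cancel₀
      have : a ∈ Finset.univ.filter (fun x => Quotient.mk s x = Quotient.mk s a) := by simp
      exact_mod_cast (Finset.card_pos.2 ⟨a, this⟩).ne'
  rw [Finset.sum_congr rfl (fun q _ => key q)]
  simp [cycleCount, Nat.card_eq_fintype_card, s]

theorem cycleCount_congr (π : Perm X) (ρ : Perm Y) (e : X ≃ Y) (h : ∀ x, e (π x) = ρ (e x)) :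
    cycleCount π = cycleCount ρ := by
  have h2 : ρ = e.permCongr π := by
    ext y
    simp [Equiv.permCongr_apply, h]
  unfold cycleCount
  refine Nat.card_congr (Quotient.congr e ?_)
  intro a b
  change π.SameCycle a b ↔ ρ.SameCycle (e a) (e b)
  subst h2
  constructor
  · rintro ⟨i, rfl⟩
    refine ⟨i, ?_⟩
    have : (e.permCongr π) ^ i = e.permCongr (π ^ i) := by
      rw [← Equiv.permCongrHom_coe, map_zpow]
    rw [this]; simp [Equiv.permCongr_apply]
  · rintro ⟨i, hi⟩
    refine ⟨i, ?_⟩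
    have : (e.permCongr π) ^ i = e.permCongr (π ^ i) := by
      rw [← Equiv.permCongrHom_coe, map_zpow]
    rw [this] at hi; simpa [Equiv.permCongr_apply] using hi

theorem sameCycle_apply_self (π : Perm X) (x : X) : π.SameCycle x (π x) := ⟨1, by simp⟩

theorem orbSize_pos [Finite X] (π : Perm X) (x : X) : 0 < orbSize π x := by
  unfold orbSize
  rw [Set.ncard_pos]
  exact ⟨x, SameCycle.refl _ _⟩

theorem two_le_orbSize [Finite X] {π : Perm X} {x : X} (h : π x ≠ x) : 2 ≤ orbSize π x := by
  rw [← Set.ncard_pair h.symm]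
  apply Set.ncard_le_ncard _ (Set.toFinite _)
  rintro y (rfl | rfl)
  · exact SameCycle.refl _ _
  · exact sameCycle_apply_self _ _

theorem three_le_orbSize [Finite X] {π : Perm X} {x : X} (h : π x ≠ x) (h2 : π (π x) ≠ x) :
    3 ≤ orbSize π x := by
  have h3 : π (π x) ≠ π x := fun h' => h (π.injective h')
  have : Set.ncard {x, π x, π (π x)} = 3 := Set.ncard_eq_three.2 ⟨_, _, _, h.symm, h2.symm, h3.symm, rfl⟩
  rw [← this]
  apply Set.ncard_le_ncard _ (Set.toFinite _)
  rintro y (rfl | rfl | rfl)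
  · exact SameCycle.refl _ _
  · exact sameCycle_apply_self _ _
  · exact (sameCycle_apply_self _ _).trans (sameCycle_apply_self _ _)

theorem subset_of_sameCycle [Finite X] {π : Perm X} {s : Set X} (hs : ∀ y ∈ s, π y ∈ s) {x y : X} (hx : x ∈ s)
    (h : π.SameCycle x y) : y ∈ s := by
  obtain ⟨n, rfl⟩ := h.exists_nat_pow_eq
  induction n with
  | zero => simpa
  | succ n ih => rw [pow_succ', Perm.mul_apply]; exact hs _ (ih ⟨n, by simp⟩)

theorem orbSize_le_of_mem [Finite X] {π : Perm X} {s : Set X} (hs : ∀ y ∈ s, π y ∈ s) {x : X} (hx : x ∈ s) :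
    orbSize π x ≤ s.ncard :=
  Set.ncard_le_ncard (fun _ hy => subset_of_sameCycle hs hx hy) (Set.toFinite _)

theorem orbSize_eq_one [Finite X] {π : Perm X} {x : X} (h : π x = x) : orbSize π x = 1 := by
  apply le_antisymm _ (orbSize_pos π x)
  rw [← Set.ncard_singleton x]
  exact orbSize_le_of_mem (by rintro y rfl; exact h) rfl

theorem orbSize_eq_two [Finite X] {π : Perm X} {x : X} (h : π x ≠ x) (h2 : π (π x) = x) :
    orbSize π x = 2 := by
  apply le_antisymm _ (two_le_orbSize h)
  rw [← Set.ncard_pair h.symm]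
  apply orbSize_le_of_mem _ (by simp)
  rintro y (rfl | rfl) <;> simp [h2]

theorem orbSize_eq_three [Finite X] {π : Perm X} {x : X} (h : π x ≠ x) (h2 : π (π x) ≠ x)
    (h3 : π (π (π x)) = x) : orbSize π x = 3 := by
  apply le_antisymm _ (three_le_orbSize h h2)
  have h4 : π (π x) ≠ π x := fun h' => h (π.injective h')
  have : Set.ncard {x, π x, π (π x)} = 3 := Set.ncard_eq_three.2 ⟨_, _, _, h.symm, h2.symm, h4.symm, rfl⟩
  rw [← this]
  apply orbSize_le_of_mem _ (by simp)
  rintro y (rfl | rfl | rfl) <;> simp [h3]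

theorem orbSize_eq_four [Finite X] {π : Perm X} {x : X} (h2 : π (π x) ≠ x)
    (h4 : π (π (π (π x))) = x) : orbSize π x = 4 := by
  have a1 : π x ≠ x := fun h => h2 (by rw [h, h])
  have a3 : π (π (π x)) ≠ x := fun h => by rw [h] at h4; exact a1 h4
  have e : (fun s : Set X => s.ncard) {x, π x, π (π x), π (π (π x))} = 4 := by
    classical
    have := Set.ncard_coe_finset ({x, π x, π (π x), π (π (π x))} : Finset X)
    simp only [Finset.coe_insert, Finset.coe_singleton] at this
    simp only [this]
    rw [Finset.card_insert_of_notMem, Finset.card_insert_of_notMem, Finset.card_insert_of_notMem,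
      Finset.card_singleton] <;> simp [a1.symm, h2.symm, a3.symm, EmbeddingLike.apply_eq_iff_eq]
  apply le_antisymm
  · rw [← e]
    apply orbSize_le_of_mem _ (by simp)
    rintro y (rfl | rfl | rfl | rfl) <;> simp [h4]
  · rw [← e]
    apply Set.ncard_le_ncard _ (Set.toFinite _)
    have q := sameCycle_apply_self π
    rintro y (rfl | rfl | rfl | rfl)
    · exact SameCycle.refl _ _
    · exact q _
    · exact (q _).trans (q _)
    · exact ((q _).trans (q _)).trans (q _)

theorem orbSize_of_semiconj [Finite X] [Finite Y] {π : Perm X} {ρ : Perm Y} {f : X → Y}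
    (hf : Function.Injective f) (h : ∀ x, f (π x) = ρ (f x)) (x : X) :
    orbSize ρ (f x) = orbSize π x := by
  unfold orbSize
  rw [← Set.ncard_image_of_injective _ hf]
  congr 1
  have hp : ∀ n : ℕ, (ρ ^ n) (f x) = f ((π ^ n) x) := by
    intro n
    induction n with
    | zero => rfl
    | succ n ih => rw [pow_succ', Perm.mul_apply, ih, pow_succ', Perm.mul_apply, h]
  ext y
  constructor
  · intro hy
    obtain ⟨n, rfl⟩ := SameCycle.exists_nat_pow_eq hy
    exact ⟨(π ^ n) x, ⟨n, by simp⟩, (hp n).symm⟩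
  · rintro ⟨z, hz, rfl⟩
    obtain ⟨n, rfl⟩ := SameCycle.exists_nat_pow_eq hz
    exact ⟨n, by simp [hp]⟩

/-- A permutation without fixed points has at most half as many cycles as points. -/
theorem two_mul_cycleCount_le [Fintype X] {π : Perm X} (h : ∀ x, π x ≠ x) :
    2 * cycleCount π ≤ Fintype.card X := by
  have h1 := cycleCount_eq_sum π
  have h2 : ∑ x, (orbSize π x : ℚ)⁻¹ ≤ ∑ _x : X, (2 : ℚ)⁻¹ := by
    apply Finset.sum_le_sum
    intro x _
    have : (2 : ℚ) ≤ orbSize π x := by exact_mod_cast two_le_orbSize (h x)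
    gcongr
  rw [← h1, Finset.sum_const, nsmul_eq_mul, Finset.card_univ] at h2
  have : (2 * cycleCount π : ℚ) ≤ Fintype.card X := by linarith
  exact_mod_cast this

theorem involutive_of_two_mul_cycleCount [Fintype X] {π : Perm X} (h : ∀ x, π x ≠ x)
    (hc : 2 * cycleCount π = Fintype.card X) (x : X) : π (π x) = x := by
  by_contra hx
  have h1 := cycleCount_eq_sum π
  have h2 : ∑ x, (orbSize π x : ℚ)⁻¹ < ∑ _x : X, (2 : ℚ)⁻¹ := by
    apply Finset.sum_lt_sum
    · intro x _
      have : (2 : ℚ) ≤ orbSize π x := by exact_mod_cast two_le_orbSize (h x)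
      gcongr
    · refine ⟨x, Finset.mem_univ _, ?_⟩
      have : (3 : ℚ) ≤ orbSize π x := by exact_mod_cast three_le_orbSize (h x) hx
      have : (orbSize π x : ℚ)⁻¹ ≤ (3 : ℚ)⁻¹ := by gcongr
      linarith [show (3 : ℚ)⁻¹ < (2 : ℚ)⁻¹ by norm_num]
  rw [← h1, Finset.sum_const, nsmul_eq_mul, Finset.card_univ, ← hc] at h2
  push_cast at h2
  linarith

theorem two_mul_cycleCount_of_involutive [Fintype X] {π : Perm X} (h : ∀ x, π x ≠ x)
    (h2 : ∀ x, π (π x) = x) : 2 * cycleCount π = Fintype.card X := by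
  have h1 := cycleCount_eq_sum π
  rw [Finset.sum_congr rfl (fun x _ => by rw [orbSize_eq_two (h x) (h2 x)]), Finset.sum_const,
    nsmul_eq_mul, Finset.card_univ] at h1
  have : (2 * cycleCount π : ℚ) = Fintype.card X := by rw [h1]; push_cast; ring
  exact_mod_cast this

theorem cycleCount_sumCongr [Fintype X] [Fintype Y] (π : Perm X) (ρ : Perm Y) :
    cycleCount (Equiv.sumCongr π ρ) = cycleCount π + cycleCount ρ := by
  have h : (cycleCount (Equiv.sumCongr π ρ) : ℚ) = cycleCount π + cycleCount ρ := by
    rw [cycleCount_eq_sum, cycleCount_eq_sum π, cycleCount_eq_sum ρ, Fintype.sum_sum_type]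
    congr 1
    · exact Finset.sum_congr rfl fun x _ => by
        rw [orbSize_of_semiconj (π := π) Sum.inl_injective (fun x => rfl)]
    · exact Finset.sum_congr rfl fun x _ => by
        rw [orbSize_of_semiconj (π := ρ) Sum.inr_injective (fun x => rfl)]
  exact_mod_cast h

/-- For a permutation without fixed points and with `m - 1` cycles on `2 m` points, at most six
points lie on cycles longer than two. -/
theorem card_not_involutive [Fintype X] [DecidableEq X] {π : Perm X} {m : ℕ} (h : ∀ x, π x ≠ x)
    (hX : Fintype.card X = 2 * m) (hc : cycleCount π + 1 = m) :
    (univ.filter fun x => π (π x) ≠ x).card = 4 ∨ (univ.filter fun x => π (π x) ≠ x).card = 6 := by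
  set D := univ.filter fun x => π (π x) ≠ x with hD
  have hDc : D.card + (univ.filter fun x => ¬ π (π x) ≠ x).card = 2 * m := by
    rw [← hX, hD, Finset.card_filter_add_card_filter_not, Finset.card_univ]
  -- The points outside `D` are paired off by `π`.
  have hev : Even (univ.filter fun x => ¬ π (π x) ≠ x).card := by
    let P : X → Prop := fun x => ¬ π (π x) ≠ x
    have hP : ∀ x, P (π x) ↔ P x := by
      intro x; simp [P, EmbeddingLike.apply_eq_iff_eq]
    let ψ : Perm {x // P x} := π.subtypePerm hP
    have := two_mul_cycleCount_of_involutive (π := ψ)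
      (fun x hx => h x (by simpa [ψ] using congrArg Subtype.val hx))
      (fun x => Subtype.ext (not_not.1 x.2))
    have e : Fintype.card {x // P x} = _ := Fintype.card_subtype P
    refine ⟨cycleCount ψ, ?_⟩
    rw [← two_mul, this]
    convert e.symm
  have hsum : (cycleCount π : ℚ) = ∑ x ∈ D, (orbSize π x : ℚ)⁻¹
      + ((univ.filter fun x => ¬ π (π x) ≠ x).card : ℚ) * 2⁻¹ := by
    rw [cycleCount_eq_sum, ← Finset.sum_filter_add_sum_filter_not univ (fun x => π (π x) ≠ x)]
    congr 1
    rw [Finset.sum_congr rfl (g := fun _ => (2 : ℚ)⁻¹), Finset.sum_const, nsmul_eq_mul]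
    intro x hx
    rw [orbSize_eq_two (h x) (by simpa using (Finset.mem_filter.1 hx).2)]
    norm_num
  have hup : ∑ x ∈ D, (orbSize π x : ℚ)⁻¹ ≤ (D.card : ℚ) * 3⁻¹ := by
    rw [← nsmul_eq_mul, ← Finset.sum_const]
    apply Finset.sum_le_sum
    intro x hx
    have : (3 : ℚ) ≤ orbSize π x := by
      exact_mod_cast three_le_orbSize (h x) (Finset.mem_filter.1 hx).2
    gcongr
  have hdc : (D.card : ℚ) + ((univ.filter fun x => ¬ π (π x) ≠ x).card : ℚ) = 2 * m := by
    exact_mod_cast hDc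
  have hc' : (cycleCount π : ℚ) + 1 = m := by exact_mod_cast hc
  -- The points of `D` contribute `|D| / 2 - 1` to the number of cycles. This is at most `|D| / 3`,
  -- hence `|D| ≤ 6`; it is nonnegative, and positive if `D` is nonempty, which excludes `|D| = 2`.
  have h6 : (D.card : ℚ) ≤ 6 := by linarith
  have h2 : (2 : ℚ) ≤ D.card := by
    have : 0 ≤ ∑ x ∈ D, (orbSize π x : ℚ)⁻¹ := Finset.sum_nonneg fun _ _ => by positivity
    linarith
  have h6' : D.card ≤ 6 := by exact_mod_cast h6
  have h2' : 2 ≤ D.card := by exact_mod_cast h2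
  have hne : D.card ≠ 2 := by
    intro h2
    have hpos : D.Nonempty := Finset.card_pos.1 (by omega)
    have : 0 < ∑ x ∈ D, (orbSize π x : ℚ)⁻¹ :=
      Finset.sum_pos (fun x _ => by have := orbSize_pos π x; positivity) hpos
    rw [h2] at hdc
    push_cast at hdc
    linarith
  obtain ⟨c, hc⟩ := hev
  omega

/-- The hypothesis `hD` says that the `|D| / l` long cycles exceed length two by a total of `2`,
which costs exactly one cycle against `m` cycles of length two. -/
theorem cycleCount_of_card_not_involutive [Fintype X] [DecidableEq X] {π : Perm X} {m l : ℕ}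
    (h : ∀ x, π x ≠ x) (hX : Fintype.card X = 2 * m) (hl : 3 ≤ l)
    (hD : (univ.filter fun x => π (π x) ≠ x).card * (l - 2) = 2 * l)
    (ho : ∀ x, π (π x) ≠ x → orbSize π x = l) : cycleCount π + 1 = m := by
  set D := univ.filter fun x => π (π x) ≠ x with hDdef
  have hDc : D.card + (univ.filter fun x => ¬ π (π x) ≠ x).card = 2 * m := by
    rw [← hX, hDdef, Finset.card_filter_add_card_filter_not, Finset.card_univ]
  have hsum : (cycleCount π : ℚ) = (D.card : ℚ) * (l : ℚ)⁻¹
      + ((univ.filter fun x => ¬ π (π x) ≠ x).card : ℚ) * 2⁻¹ := by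
    rw [cycleCount_eq_sum, ← Finset.sum_filter_add_sum_filter_not univ (fun x => π (π x) ≠ x)]
    congr 1
    · rw [Finset.sum_congr rfl (g := fun _ => (l : ℚ)⁻¹), Finset.sum_const, nsmul_eq_mul]
      intro x hx
      rw [ho x (Finset.mem_filter.1 hx).2]
    · rw [Finset.sum_congr rfl (g := fun _ => (2 : ℚ)⁻¹), Finset.sum_const, nsmul_eq_mul]
      intro x hx
      rw [orbSize_eq_two (h x) (by simpa using (Finset.mem_filter.1 hx).2)]
      norm_num
  obtain ⟨j, rfl⟩ : ∃ j, l = j + 2 := ⟨l - 2, by omega⟩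
  have hdc : (D.card : ℚ) + ((univ.filter fun x => ¬ π (π x) ≠ x).card : ℚ) = 2 * m := by
    exact_mod_cast hDc
  have hD' : (D.card : ℚ) * j = 2 * (j + 2) := by
    have : D.card * j = 2 * (j + 2) := by simpa using hD
    exact_mod_cast this
  have e : (D.card : ℚ) * ((j + 2 : ℕ) : ℚ)⁻¹ = D.card / 2 - 1 := by
    push_cast
    field_simp
    linarith
  rw [e] at hsum
  have : (cycleCount π : ℚ) + 1 = m := by linarith
  exact_mod_cast this

end CycleCount

/-! ### Back points, duality and primitive permutations -/

section BackPoints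

variable {n : ℕ}

theorem val_zeta (i : Fin n) : (zeta n i : ℕ) = if (i : ℕ) + 1 < n then (i : ℕ) + 1 else 0 := by
  cases n with
  | zero => exact i.elim0
  | succ n =>
    unfold zeta
    split_ifs with h
    · rw [finRotate_of_lt (k := i) (by omega)]
    · have : i = Fin.last n := by ext; simp; omega
      subst this; simp

/-- `i` is the smallest element of its cycle. -/
def IsCycleMin (α : Perm (Fin n)) (i : Fin n) : Prop := ∀ j, α.SameCycle i j → i ≤ j

theorem exists_isCycleMin (α : Perm (Fin n)) (i : Fin n) :
    ∃ j, α.SameCycle i j ∧ IsCycleMin α j := by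
  classical
  obtain ⟨j, hj, hmin⟩ := Finset.exists_min_image (univ.filter fun j => α.SameCycle i j) id
    ⟨i, by simp [SameCycle.refl]⟩
  have hj' : α.SameCycle i j := (Finset.mem_filter.1 hj).2
  exact ⟨j, hj', fun l hl => hmin l (by simpa using hj'.trans hl)⟩

theorem ncard_isCycleMin (α : Perm (Fin n)) : Set.ncard {i | IsCycleMin α i} = numCycles α := by
  rw [← Nat.card_coe_set_eq]
  unfold numCycles
  refine Nat.card_congr (Equiv.ofBijective
    (fun i => Quotient.mk (SameCycle.setoid α) i.1) ⟨?_, ?_⟩)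
  · rintro ⟨i, hi⟩ ⟨j, hj⟩ h
    have : α.SameCycle i j := Quotient.exact h
    exact Subtype.ext (le_antisymm (hi j this) (hj i this.symm))
  · intro q
    induction q using Quotient.inductionOn with
    | h a =>
      obtain ⟨j, hj, hm⟩ := exists_isCycleMin α a
      exact ⟨⟨j, hm⟩, Quotient.sound (show α.SameCycle j a from hj.symm)⟩

/-- If `α i ≤ i`, then either `α i` is the minimum of its cycle, which happens once per cycle (fixed
points included), or `i` is a back point. -/
theorem ncard_le_apply (α : Perm (Fin n)) :
    Set.ncard {i | α i ≤ i} = numCycles α + numBackPoints α := by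
  have h1 : Set.ncard {i | IsCycleMin α (α i)} = numCycles α := by
    rw [← ncard_isCycleMin, ← Set.ncard_image_of_injective {i | IsCycleMin α (α i)} α.injective]
    congr 1
    ext j
    constructor
    · rintro ⟨i, hi, rfl⟩; exact hi
    · intro hj; exact ⟨α.symm j, by simpa using hj, by simp⟩
  rw [← h1, numBackPoints, ← Set.ncard_union_eq]
  · congr 1
    ext i
    simp only [Set.mem_ofPred_eq, Set.mem_union, IsBackPoint]
    constructor
    · intro h
      by_cases hm : IsCycleMin α (α i)
      · exact Or.inl hm
      · right
        have hm' := hm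
        simp only [IsCycleMin, not_forall, not_le, exists_prop] at hm
        refine ⟨lt_of_le_of_ne h ?_, hm⟩
        intro he
        apply hm'
        intro j hj
        have : j ∈ ({α i} : Set (Fin n)) :=
          subset_of_sameCycle (s := {α i}) (by rintro y rfl; simp [he]) rfl hj
        rw [Set.mem_singleton_iff.1 this]
    · rintro (h | h)
      · exact h i (sameCycle_apply_self α i).symm
      · exact h.1.le
  · rw [Set.disjoint_left]
    rintro i hi ⟨_, j, hj, hlt⟩
    exact absurd (hi j hj) (not_le.2 hlt)

theorem ncard_lt_apply_add (α : Perm (Fin n)) :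
    Set.ncard {i | i < α i} + Set.ncard {i | α i ≤ i} = n := by
  have := Set.ncard_add_ncard_compl {i | i < α i}
  rw [Nat.card_fin] at this
  convert this using 3
  ext i; simp

/-- Unless `i` is the last point, `β i ≤ i` means `β i < i + 1 = α (β i)`, so that `β i` is a point
raised by `α`. The last point `l` accounts for the extra one. -/
theorem ncard_dual_le_apply (hn : 0 < n) (α : Perm (Fin n)) :
    Set.ncard {i | (α⁻¹ * zeta n) i ≤ i} = Set.ncard {i | i < α i} + 1 := by
  let l : Fin n := ⟨n - 1, by omega⟩
  have hl : (zeta n l : ℕ) = 0 := by rw [val_zeta, if_neg]; simp [l]; omega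
  let β := α⁻¹ * zeta n
  have hαβ : ∀ i, α (β i) = zeta n i := fun i => by simp [β]
  have key : {i | β i ≤ i} = insert l (β ⁻¹' {i | i < α i}) := by
    ext i
    simp only [Set.mem_ofPred_eq, Set.mem_insert_iff, Set.mem_preimage, hαβ]
    rw [Fin.lt_def, val_zeta]
    split_ifs with h
    · have : i ≠ l := by rintro rfl; simp [l] at h; omega
      rw [Fin.le_def, or_iff_right this]; omega
    · have : i = l := by ext; simp [l]; omega
      simp [this, l, Fin.le_def]; omega
  change Set.ncard {i | β i ≤ i} = _
  rw [key, Set.ncard_insert_of_notMem]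
  · rw [Set.ncard_preimage_of_injective_subset_range β.injective]
    rw [β.range_eq_univ]; exact Set.subset_univ _
  · simp only [Set.mem_preimage, Set.mem_ofPred_eq, hαβ, Fin.lt_def, hl]
    omega

/-- Together with the definition of the genus this says that a permutation of genus `g` and its dual
have `2 g` back points in total. -/
theorem numBackPoints_add (hn : 0 < n) (α : Perm (Fin n)) :
    numBackPoints α + numBackPoints (α⁻¹ * zeta n) + numCycles α + numCycles (α⁻¹ * zeta n)
      = n + 1 := by
  have h1 := ncard_le_apply α
  have h2 := ncard_le_apply (α⁻¹ * zeta n)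
  have h3 := ncard_lt_apply_add α
  have h4 := ncard_dual_le_apply hn α
  omega

/-- Without fixed points every cycle minimum is raised by `α`, so at least `numCycles α` points lie
outside those counted by `ncard_le_apply`. -/
theorem numBackPoints_le {α : Perm (Fin n)} (h : ∀ i, α i ≠ i) :
    numBackPoints α + 2 * numCycles α ≤ n := by
  have h1 := ncard_le_apply α
  have h3 := ncard_lt_apply_add α
  have h2 : numCycles α ≤ Set.ncard {i | i < α i} := by
    rw [← ncard_isCycleMin]
    apply Set.ncard_le_ncard _ (Set.toFinite _)
    intro i hi
    exact lt_of_le_of_ne (hi _ (sameCycle_apply_self α i)) (h i).symm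
  omega

/-- A permutation of genus one such that neither it nor its dual has a fixed point. -/
def IsPrimitive (α : Perm (Fin n)) : Prop :=
  HasGenus α 1 ∧ (∀ i, α i ≠ i) ∧ ∀ i, (α⁻¹ * zeta n) i ≠ i

theorem IsPrimitive.pos {α : Perm (Fin n)} (h : IsPrimitive α) : 0 < n := by
  rcases Nat.eq_zero_or_pos n with rfl | h0
  · have := h.1; unfold HasGenus at this; omega
  · exact h0

/-- Adding the inequalities `numBackPoints_le` for `α` and for its dual gives `2 + 2 (n - 1) ≤ 2 n`,
which is an equality, so both are equalities. -/
theorem IsPrimitive.numBackPoints_eq {α : Perm (Fin n)} (h : IsPrimitive α) :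
    numBackPoints α + 2 * numCycles α = n ∧ numBackPoints α + numBackPoints (α⁻¹ * zeta n) = 2 := by
  have h1 := numBackPoints_add h.pos α
  have h2 := numBackPoints_le h.2.1
  have h3 := numBackPoints_le h.2.2
  have h4 := h.1
  unfold HasGenus at h4
  omega

/-- The number of primitive permutations of `m` points with `k` cycles. -/
noncomputable def primCount (m k : ℕ) : ℕ :=
  Set.ncard {α : Perm (Fin m) | IsPrimitive α ∧ numCycles α = k}

theorem numCycles_conj (α γ : Perm (Fin n)) : numCycles (γ⁻¹ * α * γ) = numCycles α :=
  cycleCount_congr _ _ γ (fun x => by simp)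

/-- The dual of the dual is the conjugate of `α` by `zeta n`. -/
theorem IsPrimitive.dual {α : Perm (Fin n)} (h : IsPrimitive α) :
    IsPrimitive (α⁻¹ * zeta n) := by
  have e : (α⁻¹ * zeta n)⁻¹ * zeta n = (zeta n)⁻¹ * α * zeta n := by group
  refine ⟨?_, h.2.2, ?_⟩
  · have := h.1
    unfold HasGenus at this ⊢
    rw [e, numCycles_conj]
    omega
  · rw [e]
    intro i hi
    apply h.2.1 (zeta n i)
    simpa using congrArg (zeta n) hi

theorem primCount_dual {m k l : ℕ} (h : k + l + 1 = m) : primCount m k = primCount m l := by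
  have key : ∀ k l, k + l + 1 = m → primCount m k ≤ primCount m l := by
    intro k l h
    unfold primCount
    apply Set.ncard_le_ncard_of_injOn (fun α => α⁻¹ * zeta m)
    · rintro α ⟨hα, hk⟩
      refine ⟨hα.dual, ?_⟩
      have := hα.1
      unfold HasGenus at this
      omega
    · intro α _ β _ h
      simpa using h
  exact le_antisymm (key k l h) (key l k (by omega))

end BackPoints

/-! ### Contraction to the points moved by the dual -/

section Contraction

variable {m n : ℕ}

/-- The number of points of the range of `f` below `x`. -/
def countBelow (f : Fin m → Fin n) (x : ℕ) : ℕ := (univ.filter fun i => (f i : ℕ) < x).card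

theorem countBelow_apply {f : Fin m → Fin n} (hf : StrictMono f) (i : Fin m) :
    countBelow f (f i) = i := by
  unfold countBelow
  rw [show (univ.filter fun j => (f j : ℕ) < f i) = Finset.Iio i by
    ext j; simp [hf.lt_iff_lt]]
  simp

theorem countBelow_apply_succ {f : Fin m → Fin n} (hf : StrictMono f) (i : Fin m) :
    countBelow f (f i + 1) = i + 1 := by
  unfold countBelow
  rw [show (univ.filter fun j => (f j : ℕ) < f i + 1) = Finset.Iic i by
    ext j; simp [hf.le_iff_le]]
  simp

theorem countBelow_succ {f : Fin m → Fin n} {x : ℕ} (hx : ∀ i, (f i : ℕ) ≠ x) :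
    countBelow f (x + 1) = countBelow f x := by
  unfold countBelow
  congr 1
  ext j
  have := hx j
  simp; omega

theorem countBelow_zero (f : Fin m → Fin n) : countBelow f 0 = 0 := by simp [countBelow]

theorem countBelow_top (f : Fin m → Fin n) : countBelow f n = m := by simp [countBelow]

/-- The position in `f` of the first point of the range of `f` that is met from `x` on. -/
def nextIndex (hm : 0 < m) (f : Fin m → Fin n) (x : Fin n) : Fin m :=
  ⟨countBelow f x % m, Nat.mod_lt _ hm⟩

theorem nextIndex_apply (hm : 0 < m) {f : Fin m → Fin n} (hf : StrictMono f) (i : Fin m) :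
    nextIndex hm f (f i) = i := by
  ext
  simp [nextIndex, countBelow_apply hf, Nat.mod_eq_of_lt i.2]

/-- Passing a marked point raises the count by one. After the last point of `Fin n` the count drops
from `m` to `0`, which the reduction modulo `m` hides. -/
theorem nextIndex_zeta_apply (hm : 0 < m) {f : Fin m → Fin n} (hf : StrictMono f) (i : Fin m) :
    nextIndex hm f (zeta n (f i)) = zeta m i := by
  ext
  simp only [nextIndex]
  rw [val_zeta, val_zeta]
  have h1 := countBelow_apply_succ hf i
  split_ifs with h2 h3 h3
  · rw [h1, Nat.mod_eq_of_lt h3]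
  · rw [h1, show (i : ℕ) + 1 = m by omega, Nat.mod_self]
  · rw [show (f i : ℕ) + 1 = n by omega, countBelow_top] at h1
    omega
  · simp [countBelow_zero]

theorem nextIndex_zeta (hm : 0 < m) {f : Fin m → Fin n} {x : Fin n} (hx : x ∉ Set.range f) :
    nextIndex hm f (zeta n x) = nextIndex hm f x := by
  have h1 : countBelow f (x + 1) = countBelow f x :=
    countBelow_succ fun i hi => hx ⟨i, Fin.ext hi⟩
  ext
  simp only [nextIndex]
  rw [val_zeta]
  split_ifs with h2
  · rw [h1]
  · rw [← h1, show (x : ℕ) + 1 = n by omega, countBelow_top, countBelow_zero]; simp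

theorem val_zeta_pow (x : Fin n) (t : ℕ) : ((zeta n ^ t) x : ℕ) = (x + t) % n := by
  induction t with
  | zero => simp [Nat.mod_eq_of_lt x.2]
  | succ t ih =>
    rw [pow_succ', Perm.mul_apply, val_zeta, ih, ← add_assoc, ← Nat.mod_add_mod (x + t) n 1]
    have h : (x + t) % n < n := Nat.mod_lt _ x.pos
    split_ifs with h2
    · rw [Nat.mod_eq_of_lt h2]
    · rw [show (x + t) % n + 1 = n by omega, Nat.mod_self]

theorem exists_zeta_pow (x y : Fin n) : ∃ t < n, (zeta n ^ t) x = y := by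
  refine ⟨(y + (n - x)) % n, Nat.mod_lt _ x.pos, ?_⟩
  ext
  rw [val_zeta_pow, Nat.add_mod_mod, show (x : ℕ) + (y + (n - x)) = y + n by omega]
  simp [Nat.mod_eq_of_lt y.2]

/-- Walking forward from `x`, the value of `nextIndex` does not change until a marked point is
reached, and there it is the index of that point. -/
theorem exists_first_zeta_pow (hm : 0 < m) {f : Fin m → Fin n} (hf : StrictMono f) (x : Fin n) :
    ∃ p < n, (zeta n ^ p) x = f (nextIndex hm f x) ∧ ∀ t < p, (zeta n ^ t) x ∉ Set.range f := by
  classical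
  have hex : ∃ t, (zeta n ^ t) x ∈ Set.range f :=
    (exists_zeta_pow x (f ⟨0, hm⟩)).imp fun t ht => ⟨_, ht.2.symm⟩
  have hmin : ∀ t < Nat.find hex, (zeta n ^ t) x ∉ Set.range f := fun t ht => Nat.find_min hex ht
  have hconst : ∀ t ≤ Nat.find hex, nextIndex hm f ((zeta n ^ t) x) = nextIndex hm f x := by
    intro t
    induction t with
    | zero => simp
    | succ t ih =>
      intro ht
      rw [pow_succ', Perm.mul_apply, nextIndex_zeta hm (hmin t (by omega)), ih (by omega)]
  refine ⟨Nat.find hex, ?_, ?_, hmin⟩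
  · obtain ⟨t, ht, h⟩ := exists_zeta_pow x (f ⟨0, hm⟩)
    exact (Nat.find_min' hex ⟨_, h.symm⟩).trans_lt ht
  · obtain ⟨i, hi⟩ := Nat.find_spec hex
    have := hconst _ le_rfl
    rw [← hi, nextIndex_apply hm hf] at this
    rw [← hi, this]

/-- `β` acts on the range of `f` as `β'` acts on the indices, and fixes all other points. -/
structure IsInflation (f : Fin m → Fin n) (β' : Perm (Fin m)) (β : Perm (Fin n)) : Prop where
  strictMono : StrictMono f
  apply : ∀ i, β (f i) = f (β' i)
  fixed : ∀ x ∉ Set.range f, β x = x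

namespace IsInflation

variable {f : Fin m → Fin n} {β' : Perm (Fin m)} {β : Perm (Fin n)}

theorem inv_apply (h : IsInflation f β' β) (i : Fin m) : β⁻¹ (f i) = f (β'⁻¹ i) := by
  rw [Perm.inv_eq_iff_eq, h.apply]; simp

theorem inv_fixed (h : IsInflation f β' β) {x : Fin n} (hx : x ∉ Set.range f) : β⁻¹ x = x := by
  rw [Perm.inv_eq_iff_eq, h.fixed x hx]

/-- Here `zeta n * β⁻¹` is the permutation with dual `β`. At a marked point, `nextIndex` carries it
to the contracted permutation; at an unmarked point it is a step of `zeta n` that `nextIndex` does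
not see. -/
theorem nextIndex_apply (h : IsInflation f β' β) (hm : 0 < m) (i : Fin m) :
    nextIndex hm f ((zeta n * β⁻¹) (f i)) = (zeta m * β'⁻¹) i := by
  rw [Perm.mul_apply, h.inv_apply, nextIndex_zeta_apply hm h.strictMono, Perm.mul_apply]

theorem nextIndex_fixed (h : IsInflation f β' β) (hm : 0 < m) {x : Fin n}
    (hx : x ∉ Set.range f) :
    nextIndex hm f ((zeta n * β⁻¹) x) = nextIndex hm f x := by
  rw [Perm.mul_apply, h.inv_fixed hx, nextIndex_zeta hm hx]

theorem pow_eq (h : IsInflation f β' β) {x : Fin n} {t : ℕ}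
    (ht : (zeta n ^ t) x ∉ Set.range f) :
    (zeta n * β⁻¹) ((zeta n ^ t) x) = (zeta n ^ (t + 1)) x := by
  rw [Perm.mul_apply, h.inv_fixed ht, pow_succ', Perm.mul_apply]

theorem sameCycle_nextIndex (h : IsInflation f β' β) (hm : 0 < m) (x : Fin n) :
    (zeta n * β⁻¹).SameCycle x (f (nextIndex hm f x)) := by
  obtain ⟨p, -, hp, ht⟩ := exists_first_zeta_pow hm h.strictMono x
  rw [← hp]
  have : ∀ t ≤ p, (zeta n * β⁻¹).SameCycle x ((zeta n ^ t) x) := by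
    intro t
    induction t with
    | zero => simp [SameCycle.refl]
    | succ t ih =>
      intro htp
      rw [← h.pow_eq (ht t (by omega))]
      exact (ih (by omega)).trans (sameCycle_apply_self _ _)
  exact this p le_rfl

/-- Both `nextIndex` and `f` map cycles into cycles, and they are inverse to each other on cycles
because every point lies on the cycle of the next marked point. -/
theorem numCycles_zeta_mul_inv (h : IsInflation f β' β) (hm : 0 < m) :
    numCycles (zeta n * β⁻¹) = numCycles (zeta m * β'⁻¹) := by
  have h1 : ∀ x y, (zeta n * β⁻¹).SameCycle x y →
      (zeta m * β'⁻¹).SameCycle (nextIndex hm f x) (nextIndex hm f y) := by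
    intro x y hxy
    refine subset_of_sameCycle (π := zeta n * β⁻¹)
      (s := {y | (zeta m * β'⁻¹).SameCycle (nextIndex hm f x) (nextIndex hm f y)}) ?_
      (SameCycle.refl _ _) hxy
    intro y hy
    simp only [Set.mem_ofPred_eq] at hy ⊢
    by_cases hyr : y ∈ Set.range f
    · obtain ⟨i, rfl⟩ := hyr
      rw [h.nextIndex_apply hm]
      rw [GenusOne.nextIndex_apply hm h.strictMono] at hy
      exact hy.trans (sameCycle_apply_self _ _)
    · rwa [h.nextIndex_fixed hm hyr]
  have h2 : ∀ i j, (zeta m * β'⁻¹).SameCycle i j → (zeta n * β⁻¹).SameCycle (f i) (f j) := by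
    intro i j hij
    refine subset_of_sameCycle (π := zeta m * β'⁻¹)
      (s := {j | (zeta n * β⁻¹).SameCycle (f i) (f j)}) ?_ (SameCycle.refl _ _) hij
    intro j hj
    simp only [Set.mem_ofPred_eq] at hj ⊢
    rw [← h.nextIndex_apply hm]
    exact (hj.trans (sameCycle_apply_self _ _)).trans (h.sameCycle_nextIndex hm _)
  refine Nat.card_congr
    { toFun := Quotient.map (nextIndex hm f) h1
      invFun := Quotient.map f h2
      left_inv := ?_
      right_inv := ?_ }
  · intro q
    induction q using Quotient.inductionOn with
    | h x => exact Quotient.sound (h.sameCycle_nextIndex hm x).symm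
  · intro q
    induction q using Quotient.inductionOn with
    | h i => exact congrArg _ (GenusOne.nextIndex_apply hm h.strictMono i)

/-- The `n - m` unmarked points are additional fixed points of `β`. -/
theorem numCycles_add (h : IsInflation f β' β) : numCycles β + m = numCycles β' + n := by
  classical
  have hinj := h.strictMono.injective
  have hc : ((univ.filter fun x => x ∈ Set.range f).card : ℚ) = m := by
    rw [show (univ.filter fun x => x ∈ Set.range f) = univ.image f by ext; simp,
      Finset.card_image_of_injective _ hinj]
    simp
  have hn : ((univ.filter fun x => x ∈ Set.range f).card : ℚ)
      + (univ.filter fun x => ¬ x ∈ Set.range f).card = n := by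
    have := Finset.card_filter_add_card_filter_not (s := (univ : Finset (Fin n)))
      (fun x => x ∈ Set.range f)
    rw [Finset.card_univ, Fintype.card_fin] at this
    exact_mod_cast this
  have h1 : (numCycles β : ℚ) = numCycles β' + ((univ.filter fun x => ¬ x ∈ Set.range f).card : ℚ) := by
    rw [numCycles_eq_cycleCount, cycleCount_eq_sum, numCycles_eq_cycleCount,
      cycleCount_eq_sum β', ← Finset.sum_filter_add_sum_filter_not univ (fun x => x ∈ Set.range f)]
    congr 1
    · rw [show (univ.filter fun x => x ∈ Set.range f) = univ.image f by ext; simp,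
        Finset.sum_image (fun _ _ _ _ h => hinj h)]
      exact Finset.sum_congr rfl fun i _ => by
        rw [orbSize_of_semiconj hinj fun x => (h.apply x).symm]
    · rw [Finset.sum_congr rfl (g := fun _ => (1 : ℚ)), Finset.sum_const, nsmul_eq_mul, mul_one]
      intro x hx
      rw [orbSize_eq_one (h.fixed x (Finset.mem_filter.1 hx).2)]
      norm_num
  have : (numCycles β : ℚ) + m = numCycles β' + n := by rw [← hc, ← hn, h1, hc]; ring
  exact_mod_cast this

theorem numBackPoints_eq (h : IsInflation f β' β) : numBackPoints β = numBackPoints β' := by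
  have hinj := h.strictMono.injective
  have hsc : ∀ i y, β.SameCycle (f i) y ↔ ∃ j, β'.SameCycle i j ∧ y = f j := by
    intro i y
    constructor
    · intro hy
      refine subset_of_sameCycle (π := β) (s := {y | ∃ j, β'.SameCycle i j ∧ y = f j}) ?_
        ⟨i, SameCycle.refl _ _, rfl⟩ hy
      rintro _ ⟨j, hj, rfl⟩
      exact ⟨β' j, hj.trans (sameCycle_apply_self _ _), h.apply j⟩
    · rintro ⟨j, hj, rfl⟩
      refine subset_of_sameCycle (π := β') (s := {j | β.SameCycle (f i) (f j)}) ?_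
        (SameCycle.refl _ _) hj
      intro j hj
      simp only [Set.mem_ofPred_eq] at hj ⊢
      rw [← h.apply]
      exact hj.trans (sameCycle_apply_self _ _)
  unfold numBackPoints
  rw [← Set.ncard_image_of_injective _ hinj]
  congr 1
  ext x
  constructor
  · rintro ⟨hx, y, hy, hlt⟩
    by_cases hxr : x ∈ Set.range f
    · obtain ⟨i, rfl⟩ := hxr
      rw [h.apply] at hx hy hlt
      obtain ⟨j, hj, rfl⟩ := (hsc _ _).1 hy
      exact ⟨i, ⟨h.strictMono.lt_iff_lt.1 hx, j, hj, h.strictMono.lt_iff_lt.1 hlt⟩, rfl⟩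
    · rw [h.fixed x hxr] at hx
      exact absurd hx (lt_irrefl _)
  · rintro ⟨i, ⟨hi, j, hj, hlt⟩, rfl⟩
    refine ⟨?_, f j, ?_, ?_⟩
    · rw [h.apply]; exact h.strictMono hi
    · rw [h.apply]; exact (hsc _ _).2 ⟨j, hj, rfl⟩
    · rw [h.apply]; exact h.strictMono hlt

/-- A trivial cycle runs through unmarked points up to a single marked one, so it contracts to a
fixed point, and every fixed point of the contraction arises in this way. -/
theorem isReduced_iff (h : IsInflation f β' β) (hm : 0 < m) (hβ' : ∀ i, β' i ≠ i) :
    IsReduced (zeta n * β⁻¹) ↔ ∀ i, (zeta m * β'⁻¹) i ≠ i := by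
  have hfix : ∀ x, (zeta n * β⁻¹) x = zeta n x → x ∉ Set.range f := by
    rintro _ hx ⟨i, rfl⟩
    rw [Perm.mul_apply, (zeta n).injective.eq_iff, h.inv_apply,
      h.strictMono.injective.eq_iff, Perm.inv_eq_iff_eq] at hx
    exact hβ' i hx.symm
  constructor
  · intro hr j hj
    obtain ⟨p, hpn, hp, ht⟩ :=
      exists_first_zeta_pow hm h.strictMono ((zeta n * β⁻¹) (f j))
    rw [h.nextIndex_apply hm, hj] at hp
    exact hr _ p ⟨hpn, fun t htp => h.pow_eq (ht t htp), by rw [hp]⟩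
  · rintro hfp i p ⟨hpn, ht, hp⟩
    have ht' : ∀ t < p, (zeta n ^ t) i ∉ Set.range f := fun t htp => by
      apply hfix
      rw [ht t htp, pow_succ', Perm.mul_apply]
    have hnext : ∀ t ≤ p, nextIndex hm f ((zeta n ^ t) i) = nextIndex hm f i := by
      intro t
      induction t with
      | zero => simp
      | succ t ih =>
        intro htp
        rw [pow_succ', Perm.mul_apply, nextIndex_zeta hm (ht' t (by omega)), ih (by omega)]
    obtain ⟨q, -, hq, hqt⟩ := exists_first_zeta_pow hm h.strictMono i
    by_cases hpr : (zeta n ^ p) i ∈ Set.range f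
    · obtain ⟨j, hj⟩ := hpr
      have h1 := hnext p le_rfl
      rw [← hj, GenusOne.nextIndex_apply hm h.strictMono] at h1
      apply hfp j
      rw [← h.nextIndex_apply hm, hj, hp, h1]
    -- With no marked point on the trivial cycle, the walk along `zeta n` closes up after `p + 1`
    -- steps and never meets the range of `f`, although every walk does.
    · have hcyc : (zeta n ^ (p + 1)) i = i := by rw [← h.pow_eq hpr, hp]
      have hall : ∀ t, (zeta n ^ t) i ∉ Set.range f := by
        intro t
        rw [← Nat.div_add_mod t (p + 1), add_comm, pow_add, pow_mul, Perm.mul_apply]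
        have : ∀ s : ℕ, ((zeta n ^ (p + 1)) ^ s) i = i := fun s => by
          induction s with
          | zero => rfl
          | succ s ih => rw [pow_succ', Perm.mul_apply, ih, hcyc]
        rw [this]
        have hlt : t % (p + 1) < p + 1 := Nat.mod_lt t (Nat.succ_pos p)
        rcases Nat.lt_or_ge (t % (p + 1)) p with h3 | h3
        · exact ht' _ h3
        · rwa [show t % (p + 1) = p by omega]
      exact hall q (hq ▸ ⟨_, rfl⟩)

end IsInflation

end Contraction

/-! ### Reduced permutations as inflations of primitive ones -/

section ReducedCount

variable {m n : ℕ}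

theorem zeta_mul_inv_dual (α : Perm (Fin n)) : zeta n * (α⁻¹ * zeta n)⁻¹ = α := by group

theorem dual_zeta_mul_inv (β : Perm (Fin n)) : (zeta n * β⁻¹)⁻¹ * zeta n = β := by group

/-- The permutation acting on `S` as `β'` acts on the positions, and fixing all other points. -/
noncomputable def inflate (S : Finset (Fin n)) (h : S.card = m) (β' : Perm (Fin m)) :
    Perm (Fin n) :=
  β'.extendDomain (p := (· ∈ S)) (S.orderIsoOfFin h).toEquiv

theorem isInflation_inflate (S : Finset (Fin n)) (h : S.card = m) (β' : Perm (Fin m)) :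
    IsInflation (S.orderEmbOfFin h) β' (inflate S h β') where
  strictMono := (S.orderEmbOfFin h).strictMono
  apply i := β'.extendDomain_apply_image (p := (· ∈ S)) (S.orderIsoOfFin h).toEquiv i
  fixed x hx := by
    rw [Finset.range_orderEmbOfFin] at hx
    exact β'.extendDomain_apply_not_subtype (p := (· ∈ S)) _ (by simpa using hx)

theorem IsInflation.apply_ne_iff {S : Finset (Fin n)} {h : S.card = m} {β' : Perm (Fin m)}
    {β : Perm (Fin n)} (hi : IsInflation (S.orderEmbOfFin h) β' β) (hβ' : ∀ i, β' i ≠ i)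
    (x : Fin n) : β x ≠ x ↔ x ∈ S := by
  rw [← Finset.mem_coe, ← Finset.range_orderEmbOfFin S h]
  constructor
  · intro hx
    by_contra hxr
    exact hx (hi.fixed x hxr)
  · rintro ⟨i, rfl⟩
    rw [hi.apply, Ne, (S.orderEmbOfFin h).injective.eq_iff]
    exact hβ' i

theorem exists_isInflation (β : Perm (Fin n)) {S : Finset (Fin n)} (h : S.card = m)
    (hS : ∀ x, β x ≠ x ↔ x ∈ S) :
    ∃ β' : Perm (Fin m), (∀ i, β' i ≠ i) ∧ IsInflation (S.orderEmbOfFin h) β' β := by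
  have hS' : ∀ x, β x ∈ S ↔ x ∈ S := fun x => by
    rw [← hS, ← hS]; simp
  let β' : Perm (Fin m) :=
    (S.orderIsoOfFin h).toEquiv.symm.permCongr (β.subtypePerm (p := (· ∈ S)) hS')
  have hap : ∀ i, β (S.orderEmbOfFin h i) = S.orderEmbOfFin h (β' i) := by
    intro i
    have : S.orderIsoOfFin h (β' i) = (β.subtypePerm (p := (· ∈ S)) hS') (S.orderIsoOfFin h i) := by
      simp [β', Equiv.permCongr_apply]
    have := congrArg Subtype.val this
    simpa using this.symm
  refine ⟨β', ?_, (S.orderEmbOfFin h).strictMono, hap, ?_⟩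
  · intro i hi
    have := hap i
    rw [hi] at this
    exact (hS _).2 (Finset.orderEmbOfFin_mem S h i) this
  · intro x hx
    rw [Finset.range_orderEmbOfFin] at hx
    by_contra hne
    exact hx ((hS x).1 hne)

/-- The genus is preserved because `n` and the number of cycles of the dual change by the same
amount, while the cycles of the permutation itself correspond. -/
theorem IsInflation.primitive_iff {f : Fin m → Fin n} {β' : Perm (Fin m)} {β : Perm (Fin n)}
    (hi : IsInflation f β' β) (hm : 0 < m) (hβ' : ∀ i, β' i ≠ i) :
    (IsReduced (zeta n * β⁻¹) ∧ HasGenus (zeta n * β⁻¹) 1) ↔ IsPrimitive (zeta m * β'⁻¹) := by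
  rw [hi.isReduced_iff hm hβ']
  unfold IsPrimitive HasGenus
  rw [dual_zeta_mul_inv, dual_zeta_mul_inv, hi.numCycles_zeta_mul_inv hm]
  have := hi.numCycles_add
  constructor
  · rintro ⟨h1, h2⟩
    exact ⟨by omega, h1, hβ'⟩
  · rintro ⟨h1, h2, h3⟩
    exact ⟨h2, by omega⟩

/-- Only the dual `β` is an inflation in the literal sense; the identity `numBackPoints_add`
transfers the statement from it to `zeta n * β⁻¹`. -/
theorem IsInflation.numBackPoints_zeta_mul_inv {f : Fin m → Fin n} {β' : Perm (Fin m)}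
    {β : Perm (Fin n)} (hi : IsInflation f β' β) (hm : 0 < m) :
    numBackPoints (zeta n * β⁻¹) = numBackPoints (zeta m * β'⁻¹) := by
  have hn : 0 < n := (f ⟨0, hm⟩).pos
  have h1 := numBackPoints_add hn (zeta n * β⁻¹)
  have h2 := numBackPoints_add hm (zeta m * β'⁻¹)
  rw [dual_zeta_mul_inv, hi.numCycles_zeta_mul_inv hm, hi.numBackPoints_eq] at h1
  rw [dual_zeta_mul_inv] at h2
  have := hi.numCycles_add
  omega

theorem exists_primitive_of_reduced {α : Perm (Fin n)} (hr : IsReduced α) (hg : HasGenus α 1) :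
    ∃ (m : ℕ) (S : Finset (Fin n)) (h : S.card = m) (α' : Perm (Fin m)), IsPrimitive α' ∧
      numCycles α' = numCycles α ∧ numBackPoints α' = numBackPoints α ∧
      zeta n * (inflate S h (α'⁻¹ * zeta m))⁻¹ = α := by
  classical
  let β := α⁻¹ * zeta n
  let S := univ.filter fun x => β x ≠ x
  obtain ⟨β', hβ', hi⟩ := exists_isInflation β (S := S) rfl (fun x => by simp [S])
  -- If `β` moved no point it would have `n` cycles, and genus one would require `n + 1 ≥ n + 2`.
  have hm : 0 < S.card := by
    rw [Finset.card_pos]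
    by_contra hne
    rw [Finset.not_nonempty_iff_eq_empty, Finset.filter_eq_empty_iff] at hne
    have h1 : numCycles β = n := by
      have : (cycleCount β : ℚ) = n := by
        rw [cycleCount_eq_sum, Finset.sum_congr rfl (g := fun _ => (1 : ℚ))]
        · simp
        · intro x hx
          rw [orbSize_eq_one (not_not.1 (hne hx))]; norm_num
      exact_mod_cast this
    unfold HasGenus at hg
    change n + 1 = _ + numCycles β + _ at hg
    omega
  have hα : zeta n * β⁻¹ = α := zeta_mul_inv_dual α
  refine ⟨S.card, S, rfl, zeta _ * β'⁻¹, ?_, ?_, ?_, ?_⟩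
  · rw [← hi.primitive_iff hm hβ', hα]; exact ⟨hr, hg⟩
  · rw [← hi.numCycles_zeta_mul_inv hm, hα]
  · rw [← hi.numBackPoints_zeta_mul_inv hm, hα]
  · rw [dual_zeta_mul_inv, ← hα]
    congr 2
    ext1 x
    have hi' := isInflation_inflate S rfl β'
    by_cases hx : x ∈ Set.range (S.orderEmbOfFin rfl)
    · obtain ⟨i, rfl⟩ := hx
      rw [hi.apply, hi'.apply]
    · rw [hi.fixed x hx, hi'.fixed x hx]

/-- A reduced permutation corresponds to the set of points moved by its dual and to its contraction.
The size of that set is `m` because a primitive permutation has as many points as back points plus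
twice its cycles. -/
theorem ncard_reduced (n m k : ℕ) :
    Set.ncard {α : Perm (Fin n) | IsReduced α ∧ HasGenus α 1 ∧ numCycles α = k ∧
      numBackPoints α + 2 * k = m} = n.choose m * primCount m k := by
  have hS : Set.ncard {S : Finset (Fin n) | S.card = m} = n.choose m := by
    rw [show {S : Finset (Fin n) | S.card = m} = ↑(Finset.powersetCard m (univ : Finset (Fin n)))
      by ext; simp, Set.ncard_coe_finset, Finset.card_powersetCard, Finset.card_fin]
  rw [← hS, primCount, ← Set.ncard_prod]
  symm
  refine Set.ncard_congr (fun p hp => zeta n * (inflate p.1 hp.1 (p.2⁻¹ * zeta m))⁻¹) ?_ ?_ ?_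
  · rintro ⟨S, α⟩ ⟨hS, hp, hk⟩
    have hi := isInflation_inflate S hS (α⁻¹ * zeta m)
    have hb := (hi.primitive_iff hp.pos hp.2.2).2 (by rwa [zeta_mul_inv_dual])
    refine ⟨hb.1, hb.2, ?_, ?_⟩
    · rw [hi.numCycles_zeta_mul_inv hp.pos, zeta_mul_inv_dual]; exact hk
    · rw [hi.numBackPoints_zeta_mul_inv hp.pos, zeta_mul_inv_dual, ← show numCycles α = k from hk]
      exact hp.numBackPoints_eq.1
  · rintro ⟨S, α⟩ ⟨T, γ⟩ ⟨hS, hp, hk⟩ ⟨hT, hq, hl⟩ h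
    simp only [mul_right_inj, inv_inj] at h
    have hi := isInflation_inflate S hS (α⁻¹ * zeta m)
    have hj := isInflation_inflate T hT (γ⁻¹ * zeta m)
    have hST : S = T := by
      ext x
      rw [← hi.apply_ne_iff hp.2.2, ← hj.apply_ne_iff hq.2.2]
      rw [h]
    subst hST
    have : α⁻¹ * zeta m = γ⁻¹ * zeta m := by
      ext1 i
      apply hi.strictMono.injective
      rw [← hi.apply, ← hj.apply]
      rw [h]
    simpa using this
  · rintro α ⟨hr, hg, hk, hb⟩
    obtain ⟨m', S, h, α', hp, h1, h2, h3⟩ := exists_primitive_of_reduced hr hg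
    have := hp.numBackPoints_eq.1
    obtain rfl : m' = m := by omega
    exact ⟨(S, α'), ⟨h, hp, h1.trans hk⟩, h3⟩

theorem r_eq (j n k : ℕ) : r j n k = n.choose (2 * k + j) * primCount (2 * k + j) k := by
  rw [← ncard_reduced, r]
  congr 1
  ext α
  simp only [Set.mem_ofPred_eq]
  constructor
  · rintro ⟨h1, h2, h3, h4⟩; exact ⟨h1, h2, h3, by omega⟩
  · rintro ⟨h1, h2, h3, h4⟩; exact ⟨h1, h2, h3, by omega⟩

theorem rStar_eq (n k : ℕ) : rStar n k = r 0 n k + r 1 n k + r 2 n k := by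
  unfold rStar r
  rw [← Set.ncard_union_eq, ← Set.ncard_union_eq]
  · congr 1
    ext α
    simp only [Set.mem_ofPred_eq, Set.mem_union]
    constructor
    · rintro ⟨hr, hg, hk⟩
      obtain ⟨m', S, h, α', hp, h1, h2, h3⟩ := exists_primitive_of_reduced hr hg
      have := hp.numBackPoints_eq.2
      have : numBackPoints α = 0 ∨ numBackPoints α = 1 ∨ numBackPoints α = 2 := by omega
      tauto
    · tauto
  · rw [Set.disjoint_left]
    rintro α (⟨-, -, -, h⟩ | ⟨-, -, -, h⟩) ⟨-, -, -, h'⟩ <;> omega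
  · rw [Set.disjoint_left]
    rintro α ⟨-, -, -, h⟩ ⟨-, -, -, h'⟩
    omega

end ReducedCount

/-! ### Gaps of a subset of the cyclic group -/

section Gaps

variable {N : ℕ} [NeZero N]

/-- The number of steps from `x` forward to the first point of `D`. -/
noncomputable def fwd (D : Finset (ZMod N)) (x : ZMod N) : ℕ := sInf {u : ℕ | x + u ∈ D}

/-- The number of steps from `x` backward to the first point of `D` other than `x` itself. -/
noncomputable def bwd (D : Finset (ZMod N)) (x : ZMod N) : ℕ := sInf {t : ℕ | 1 ≤ t ∧ x - t ∈ D}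

/-- The number of steps from `x` to the next point of `D`. -/
noncomputable def gap (D : Finset (ZMod N)) (x : ZMod N) : ℕ := fwd D (x + 1) + 1

/-- The first point of `D` after `x`. -/
noncomputable def succPoint (D : Finset (ZMod N)) (x : ZMod N) : ZMod N := x + gap D x

variable {D : Finset (ZMod N)}

theorem fwd_mem (hD : D.Nonempty) (x : ZMod N) : x + fwd D x ∈ D := by
  obtain ⟨d, hd⟩ := hD
  exact Nat.sInf_mem (s := {u : ℕ | x + u ∈ D}) ⟨(d - x).val, by simpa using hd⟩

theorem bwd_spec (hD : D.Nonempty) (x : ZMod N) : 1 ≤ bwd D x ∧ x - bwd D x ∈ D := by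
  obtain ⟨d, hd⟩ := hD
  -- Adding `N` makes the witness positive also when `d = x`.
  refine Nat.sInf_mem (s := {t : ℕ | 1 ≤ t ∧ x - t ∈ D}) ⟨(x - d).val + N, ?_, ?_⟩
  · have := NeZero.pos N; omega
  · simpa using hd

theorem notMem_of_between (x : ZMod N) (j : ℤ) (h1 : -(bwd D x : ℤ) < j)
    (h2 : j < fwd D x) : x + j ∉ D := by
  intro hj
  rcases le_or_gt 0 j with h | h
  · obtain ⟨u, rfl⟩ := Int.eq_ofNat_of_zero_le h
    have : fwd D x ≤ u := Nat.sInf_le (s := {u : ℕ | x + u ∈ D}) (by simpa using hj)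
    omega
  · obtain ⟨t, rfl⟩ : ∃ t : ℕ, j = -t := ⟨j.natAbs, by omega⟩
    have : bwd D x ≤ t := Nat.sInf_le (s := {t : ℕ | 1 ≤ t ∧ x - t ∈ D})
      ⟨by omega, by simpa [sub_eq_add_neg] using hj⟩
    omega

theorem fwd_bwd_eq {x : ZMod N} {T U : ℕ} (hT : 1 ≤ T) (h1 : x - T ∈ D) (h2 : x + U ∈ D)
    (h : ∀ j : ℤ, -(T : ℤ) < j → j < U → x + j ∉ D) : fwd D x = U ∧ bwd D x = T := by
  have hne : D.Nonempty := ⟨_, h1⟩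
  have a1 : fwd D x ≤ U := Nat.sInf_le h2
  have a2 : bwd D x ≤ T := Nat.sInf_le ⟨hT, h1⟩
  have a3 := fwd_mem hne x
  have a4 := bwd_spec hne x
  constructor
  · by_contra hlt
    exact h (fwd D x) (by omega) (by omega) (by simpa using a3)
  · by_contra hlt
    exact h (-(bwd D x : ℤ)) (by omega) (by omega) (by simpa [sub_eq_add_neg] using a4.2)

theorem gap_pos (x : ZMod N) : 0 < gap D x := Nat.succ_pos _

theorem succPoint_mem (hD : D.Nonempty) (x : ZMod N) : succPoint D x ∈ D := by
  have := fwd_mem hD (x + 1)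
  unfold succPoint gap
  push_cast
  convert this using 1
  ring

theorem notMem_of_lt_gap {x : ZMod N} {j : ℕ} (h1 : 0 < j) (h2 : j < gap D x) :
    x + j ∉ D := by
  intro hj
  have : fwd D (x + 1) ≤ j - 1 := Nat.sInf_le (s := {u : ℕ | x + 1 + u ∈ D}) (by
    simp only [Set.mem_ofPred_eq]
    rw [Nat.cast_sub h1]
    convert hj using 1
    push_cast; ring)
  unfold gap at h2
  omega

theorem gap_eq {x : ZMod N} {L : ℕ} (hL : 0 < L) (h1 : x + L ∈ D)
    (h : ∀ j : ℕ, 0 < j → j < L → x + j ∉ D) : gap D x = L := by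
  have hne : D.Nonempty := ⟨_, h1⟩
  have h2 : fwd D (x + 1) ≤ L - 1 := Nat.sInf_le (s := {u : ℕ | x + 1 + u ∈ D}) (by
    simp only [Set.mem_ofPred_eq]
    rw [Nat.cast_sub hL]
    convert h1 using 1
    push_cast; ring)
  by_contra hlt
  refine h (gap D x) (gap_pos x) ?_ (succPoint_mem hne x)
  unfold gap at hlt ⊢
  omega

/-- The `i`-th point of `D` after `x`, for `x` in `D`. -/
noncomputable def point (D : Finset (ZMod N)) (x : ZMod N) (i : ℕ) : ZMod N := (succPoint D)^[i] x

theorem point_zero (x : ZMod N) : point D x 0 = x := rfl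

theorem point_succ (x : ZMod N) (i : ℕ) : point D x (i + 1) = succPoint D (point D x i) :=
  Function.iterate_succ_apply' _ _ _

theorem point_mem {x : ZMod N} (hx : x ∈ D) (i : ℕ) : point D x i ∈ D := by
  cases i with
  | zero => exact hx
  | succ i => rw [point_succ]; exact succPoint_mem ⟨x, hx⟩ _

theorem point_eq (x : ZMod N) (i : ℕ) :
    point D x i = x + (∑ l ∈ range i, gap D (point D x l) : ℕ) := by
  induction i with
  | zero => simp [point_zero]
  | succ i ih =>
    rw [point_succ, succPoint, Finset.sum_range_succ, Nat.cast_add, ← add_assoc, ← ih]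

/-- The partial sums increase strictly and cannot jump over `s`, because no point of `D` lies
strictly inside a gap. -/
theorem exists_sum_gap_eq {x : ZMod N} {s : ℕ} (hs : x + s ∈ D) :
    ∃ i, ∑ l ∈ range i, gap D (point D x l) = s := by
  have hmono : StrictMono fun i => ∑ l ∈ range i, gap D (point D x l) :=
    strictMono_nat_of_lt_succ fun i => by
      simp only [Finset.sum_range_succ]
      have := gap_pos (D := D) (point D x i)
      omega
  by_contra hcon
  push Not at hcon
  have key : ∀ i, ∑ l ∈ range i, gap D (point D x l) < s := by
    intro i
    induction i with
    | zero => exact lt_of_le_of_ne (by simp) (hcon 0)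
    | succ i ih =>
      by_contra hge
      have hge' := lt_of_le_of_ne (not_lt.1 hge) (hcon (i + 1)).symm
      rw [Finset.sum_range_succ] at hge'
      refine notMem_of_lt_gap (D := D) (x := point D x i)
        (j := s - ∑ l ∈ range i, gap D (point D x l)) (by omega) (by omega) ?_
      rw [point_eq, Nat.cast_sub ih.le]
      convert hs using 1
      ring
  exact absurd (hmono.le_apply (x := s)) (not_le.2 (key s))

theorem sum_gap (x : ZMod N) (hx : x ∈ D) :
    ∑ l ∈ range D.card, gap D (point D x l) = N ∧
      (∀ y ∈ D, ∃ i < D.card, point D x i = y) ∧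
      ∀ i < D.card, ∀ j < D.card, point D x i = point D x j → i = j := by
  have hmono : StrictMono fun i => ∑ l ∈ range i, gap D (point D x l) :=
    strictMono_nat_of_lt_succ fun i => by
      simp only [Finset.sum_range_succ]
      have := gap_pos (D := D) (point D x i)
      omega
  -- Since `x + N = x`, some partial sum equals a full turn. The points before it are distinct and
  -- exhaust `D`, so `M` is the cardinality of `D`.
  obtain ⟨M, hM⟩ := exists_sum_gap_eq (D := D) (x := x) (s := N) (by simpa using hx)
  have hinj : ∀ i < M, ∀ j < M, point D x i = point D x j → i = j := by
    intro i hi j hj h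
    rw [point_eq, point_eq x j, add_right_inj, ZMod.natCast_eq_natCast_iff'] at h
    have h1 := hmono hi
    have h2 := hmono hj
    simp only [hM] at h1 h2
    rw [Nat.mod_eq_of_lt h1, Nat.mod_eq_of_lt h2] at h
    exact hmono.injective h
  have hsurj : ∀ y ∈ D, ∃ i < M, point D x i = y := by
    intro y hy
    obtain ⟨i, hi⟩ := exists_sum_gap_eq (D := D) (x := x) (s := (y - x).val) (by simpa using hy)
    refine ⟨i, ?_, by rw [point_eq, hi]; simp⟩
    have := (y - x).val_lt
    rw [← hi] at this
    exact hmono.lt_iff_lt.1 (this.trans_eq hM.symm)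
  have hcard : D.card = M := by
    have : D = (range M).image (point D x) := by
      ext y
      simp only [Finset.mem_image, Finset.mem_range]
      exact ⟨hsurj y, fun ⟨i, _, h⟩ => h ▸ point_mem hx i⟩
    rw [this, Finset.card_image_of_injOn, Finset.card_range]
    intro i hi j hj h
    exact hinj i (by simpa using hi) j (by simpa using hj) h
  rw [hcard]
  exact ⟨hM, hsurj, hinj⟩

theorem point_add_card {x : ZMod N} (hx : x ∈ D) (i : ℕ) :
    point D x (i + D.card) = point D x i := by
  have h : point D x D.card = x := by rw [point_eq, (sum_gap x hx).1]; simp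
  rw [point, Function.iterate_add_apply]
  exact congrArg _ h

theorem point_mod_card {x : ZMod N} (hx : x ∈ D) (i : ℕ) :
    point D x (i % D.card) = point D x i := by
  conv_rhs => rw [← Nat.mod_add_div i D.card]
  induction i / D.card with
  | zero => simp
  | succ k ih => rw [Nat.mul_succ, ← add_assoc, point_add_card hx, ih]

end Gaps

/-! ### A gluing matches opposite intervals -/

section Forward

variable {N : ℕ} [NeZero N]

/-- The permutation `x ↦ σ (x + 1)`. -/
def shiftPerm (σ : Perm (ZMod N)) : Perm (ZMod N) := σ * Equiv.addRight 1

theorem shiftPerm_apply (σ : Perm (ZMod N)) (x : ZMod N) : shiftPerm σ x = σ (x + 1) := rfl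

/-- The points that do not lie on a cycle of length at most two. -/
def longSet (φ : Perm (ZMod N)) : Finset (ZMod N) := univ.filter fun x => φ (φ x) ≠ x

theorem mem_longSet {φ : Perm (ZMod N)} {x : ZMod N} : x ∈ longSet φ ↔ φ (φ x) ≠ x := by
  simp [longSet]

theorem apply_mem_longSet {φ : Perm (ZMod N)} {x : ZMod N} : φ x ∈ longSet φ ↔ x ∈ longSet φ := by
  simp [longSet]

variable {σ : Perm (ZMod N)}

theorem apply_add_one_of_notMem (hσ : ∀ x, σ (σ x) = x) {x : ZMod N}
    (hx : x ∉ longSet (shiftPerm σ)) : σ (x + 1) = σ x - 1 := by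
  rw [mem_longSet, not_not, shiftPerm_apply, shiftPerm_apply] at hx
  have h := congrArg σ hx
  rw [hσ] at h
  rw [← h]
  ring

/-- At a point on a cycle of length two of `shiftPerm σ`, `σ` reverses direction; hence it reverses
the whole interval between two consecutive long points. -/
theorem apply_add_of_lt_gap (hσ : ∀ x, σ (σ x) = x) (d : ZMod N) {s : ℕ}
    (hs : s < gap (longSet (shiftPerm σ)) d) : σ (d + 1 + s) = shiftPerm σ d - s := by
  induction s with
  | zero => simp [shiftPerm_apply]
  | succ s ih =>
    have h1 : d + 1 + s ∉ longSet (shiftPerm σ) := by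
      have := notMem_of_lt_gap (D := longSet (shiftPerm σ)) (x := d) (Nat.succ_pos s) hs
      convert this using 2
      push_cast; ring
    have h2 := apply_add_one_of_notMem hσ h1
    rw [ih (by omega)] at h2
    push_cast
    rw [← add_assoc, h2]
    ring

/-- The interval after `d` is reversed onto the interval of the same length `L` that ends at
`shiftPerm σ d`. The partner `e = shiftPerm σ d - L` is the long point preceding it. -/
theorem exists_partner (hσ : ∀ x, σ (σ x) = x) (hfix : ∀ x, σ x ≠ x)
    (hφ : ∀ x, shiftPerm σ x ≠ x) {d : ZMod N} (hd : d ∈ longSet (shiftPerm σ)) :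
    ∃ e ∈ longSet (shiftPerm σ), e ≠ d ∧
      gap (longSet (shiftPerm σ)) e = gap (longSet (shiftPerm σ)) d ∧
      succPoint (longSet (shiftPerm σ)) e = shiftPerm σ d ∧
      shiftPerm σ e = succPoint (longSet (shiftPerm σ)) d := by
  set D := longSet (shiftPerm σ) with hD
  set L := gap D d with hL
  have hL0 : 0 < L := gap_pos d
  have hs : ∀ s < L, σ (d + 1 + s) = shiftPerm σ d - s := fun s h => apply_add_of_lt_gap hσ d h
  have hlast : σ (d + L) = shiftPerm σ d - L + 1 := by
    have := hs (L - 1) (by omega)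
    rw [Nat.cast_sub hL0] at this
    convert this using 1
    · congr 1; push_cast; ring
    · push_cast; ring
  have hφe : shiftPerm σ (shiftPerm σ d - L) = d + L := by
    rw [shiftPerm_apply, ← hlast, hσ]
  have hdL : d + L ∈ D := succPoint_mem ⟨d, hd⟩ d
  have he : shiftPerm σ d - L ∈ D := by
    rw [hD, ← apply_mem_longSet, hφe]; exact hdL
  have hφd : shiftPerm σ d ∈ D := apply_mem_longSet.2 hd
  have hgap : gap D (shiftPerm σ d - L) = L := by
    refine gap_eq hL0 (by simpa using hφd) fun j hj hjL => ?_
    rw [hD, mem_longSet, not_not]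
    obtain ⟨s, hsL⟩ : ∃ s, L = j + (s + 1) := ⟨L - j - 1, by omega⟩
    have hLc : (L : ZMod N) = j + (s + 1) := by rw [hsL]; push_cast; rfl
    have h1 := hs (s + 1) (by omega)
    have h2 := hs s (by omega)
    have e1 : shiftPerm σ d - L + j = σ (d + 1 + (s + 1 : ℕ)) := by
      rw [h1, hLc]; push_cast; ring
    have e2 : shiftPerm σ (σ (d + 1 + (s + 1 : ℕ))) = d + 1 + s := by
      rw [shiftPerm_apply, h1, ← hσ (d + 1 + s), h2]
      congr 1
      push_cast; ring
    rw [e1, e2, shiftPerm_apply]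
    congr 1
    push_cast; ring
  refine ⟨_, he, ?_, hgap, ?_, hφe⟩
  · intro h
    -- An interval reversed onto itself has a centre, which is a fixed point of `shiftPerm σ` for
    -- even `L` and of `σ` for odd `L`.
    rw [sub_eq_iff_eq_add] at h
    rcases Nat.even_or_odd' L with ⟨c, hc | hc⟩
    · apply hφ (d + c)
      have := hs c (by omega)
      rw [shiftPerm_apply, add_right_comm, this, h, hc]
      push_cast; ring
    · apply hfix (d + 1 + c)
      rw [hs c (by omega), h, hc]
      push_cast; ring
  · rw [succPoint, hgap]; simp

/-- With the long points numbered cyclically, `t` is the matching of their intervals and `shiftPerm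
σ` acts as `i ↦ t i + 1`. The absence of cycles of length one and two among them gives the third and
fourth conditions on `t`. -/
theorem exists_index_involution (hσ : ∀ x, σ (σ x) = x) (hfix : ∀ x, σ x ≠ x)
    (hφ : ∀ x, shiftPerm σ x ≠ x) {M : ℕ} [NeZero M] (hM : (longSet (shiftPerm σ)).card = M)
    {x : ZMod N} (hx : x ∈ longSet (shiftPerm σ)) :
    ∃ t : Fin M → Fin M, (∀ i, t (t i) = i) ∧ (∀ i, t i ≠ i) ∧ (∀ i, t i + 1 ≠ i) ∧
      (∀ i, t (t i + 1) + 1 ≠ i) ∧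
      (∀ i : Fin M, gap (longSet (shiftPerm σ)) (point (longSet (shiftPerm σ)) x (t i))
        = gap (longSet (shiftPerm σ)) (point (longSet (shiftPerm σ)) x i)) ∧
      ∀ i : Fin M, shiftPerm σ (point (longSet (shiftPerm σ)) x i)
        = point (longSet (shiftPerm σ)) x ((t i : ℕ) + 1) := by
  set D := longSet (shiftPerm σ) with hD
  obtain ⟨-, hsurj, hinj⟩ := sum_gap x hx
  rw [hM] at hsurj hinj
  have hinj' : ∀ i j : Fin M, point D x i = point D x j → i = j := fun i j h =>
    Fin.ext (hinj i i.2 j j.2 h)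
  have hsucc : ∀ i : Fin M, point D x (i + 1 : Fin M) = point D x ((i : ℕ) + 1) := by
    intro i
    rw [← point_mod_card hx (i + 1), hM]
    congr 1
    rw [Fin.val_add, Fin.val_one', Nat.add_mod_mod]
  have hex : ∀ i : Fin M, ∃ j : Fin M, j ≠ i ∧ gap D (point D x j) = gap D (point D x i) ∧
      point D x ((j : ℕ) + 1) = shiftPerm σ (point D x i) ∧
      shiftPerm σ (point D x j) = point D x ((i : ℕ) + 1) := by
    intro i
    obtain ⟨e, he, h1, h2, h3, h4⟩ := exists_partner hσ hfix hφ (point_mem hx i)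
    obtain ⟨j, hj, rfl⟩ := hsurj e he
    refine ⟨⟨j, hj⟩, ?_, h2, ?_, ?_⟩
    · rintro rfl; exact h1 rfl
    · rw [point_succ]; exact h3
    · rw [point_succ]; exact h4
  choose t h1 h2 h3 h4 using hex
  refine ⟨t, ?_, h1, ?_, ?_, h2, fun i => (h3 i).symm⟩
  · intro i
    have : t (t i) + 1 = i + 1 := hinj' _ _ (by rw [hsucc, hsucc, h3, h4])
    exact add_right_cancel this
  · intro i hi
    apply hφ (point D x i)
    rw [← h3, ← hsucc, hi]
  · intro i hi
    have := mem_longSet.1 (point_mem hx i)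
    apply this
    rw [← h3, ← hsucc, ← h3, ← hsucc, hi]

/-- Two values `t i = a` and `t j = b` that may occur in a fixed-point-free involution `t` for
which `i ↦ t i + 1` has no cycle of length two. -/
def IsCompatible {M : ℕ} [NeZero M] (i a j b : Fin M) : Prop :=
  (a = j ↔ b = i) ∧ ¬ (a + 1 = j ∧ b + 1 = i)

instance {M : ℕ} [NeZero M] (i a j b : Fin M) : Decidable (IsCompatible i a j b) := by
  unfold IsCompatible; infer_instance

theorem isCompatible_apply {M : ℕ} [NeZero M] {t : Fin M → Fin M} (h1 : ∀ i, t (t i) = i)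
    (h4 : ∀ i, t (t i + 1) + 1 ≠ i) (i j : Fin M) : IsCompatible i (t i) j (t j) := by
  refine ⟨⟨?_, ?_⟩, ?_⟩
  · rintro rfl; exact h1 i
  · rintro rfl; exact h1 j
  · rintro ⟨rfl, h⟩; exact h4 i h

set_option maxRecDepth 10000 in
set_option synthInstance.maxSize 4000 in
set_option synthInstance.maxHeartbeats 400000 in
-- The values of `t` are chosen one at a time and tested against the earlier ones, so that `decide`
-- discards bad choices early.
theorem involution_fin_four (t : Fin 4 → Fin 4) (h1 : ∀ i, t (t i) = i) (h2 : ∀ i, t i ≠ i)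
    (h3 : ∀ i, t i + 1 ≠ i) (h4 : ∀ i, t (t i + 1) + 1 ≠ i) : ∀ i, t i = i + 2 := by
  have key : ∀ a : Fin 4, a ≠ 0 → a + 1 ≠ 0 → 
        ∀ b : Fin 4, b ≠ 1 → b + 1 ≠ 1 → IsCompatible 0 a 1 b → 
        ∀ c : Fin 4, c ≠ 2 → c + 1 ≠ 2 → IsCompatible 0 a 2 c → IsCompatible 1 b 2 c → 
        ∀ d : Fin 4, d ≠ 3 → d + 1 ≠ 3 → IsCompatible 0 a 3 d → IsCompatible 1 b 3 d → IsCompatible 2 c 3 d → 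
        a = 0 + 2 ∧ b = 1 + 2 ∧ c = 2 + 2 ∧ d = 3 + 2 := by decide
  have c := isCompatible_apply h1 h4
  have := key (t 0) (h2 0) (h3 0) (t 1) (h2 1) (h3 1) (c 0 1) (t 2) (h2 2) (h3 2) (c 0 2) (c 1 2) (t 3) (h2 3) (h3 3) (c 0 3) (c 1 3) (c 2 3)
  intro i
  fin_cases i <;> tauto

set_option maxRecDepth 10000 in
set_option synthInstance.maxSize 4000 in
set_option synthInstance.maxHeartbeats 400000 in
theorem involution_fin_six (t : Fin 6 → Fin 6) (h1 : ∀ i, t (t i) = i) (h2 : ∀ i, t i ≠ i)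
    (h3 : ∀ i, t i + 1 ≠ i) (h4 : ∀ i, t (t i + 1) + 1 ≠ i) : ∀ i, t i = i + 3 := by
  have key : ∀ a : Fin 6, a ≠ 0 → a + 1 ≠ 0 → 
        ∀ b : Fin 6, b ≠ 1 → b + 1 ≠ 1 → IsCompatible 0 a 1 b → 
        ∀ c : Fin 6, c ≠ 2 → c + 1 ≠ 2 → IsCompatible 0 a 2 c → IsCompatible 1 b 2 c → 
        ∀ d : Fin 6, d ≠ 3 → d + 1 ≠ 3 → IsCompatible 0 a 3 d → IsCompatible 1 b 3 d → IsCompatible 2 c 3 d → 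
        ∀ e : Fin 6, e ≠ 4 → e + 1 ≠ 4 → IsCompatible 0 a 4 e → IsCompatible 1 b 4 e → IsCompatible 2 c 4 e → IsCompatible 3 d 4 e → 
        ∀ f : Fin 6, f ≠ 5 → f + 1 ≠ 5 → IsCompatible 0 a 5 f → IsCompatible 1 b 5 f → IsCompatible 2 c 5 f → IsCompatible 3 d 5 f → IsCompatible 4 e 5 f → 
        a = 0 + 3 ∧ b = 1 + 3 ∧ c = 2 + 3 ∧ d = 3 + 3 ∧ e = 4 + 3 ∧ f = 5 + 3 := by decide
  have c := isCompatible_apply h1 h4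
  have := key (t 0) (h2 0) (h3 0) (t 1) (h2 1) (h3 1) (c 0 1) (t 2) (h2 2) (h3 2) (c 0 2) (c 1 2) (t 3) (h2 3) (h3 3) (c 0 3) (c 1 3) (c 2 3) (t 4) (h2 4) (h3 4) (c 0 4) (c 1 4) (c 2 4) (c 3 4) (t 5) (h2 5) (h3 5) (c 0 5) (c 1 5) (c 2 5) (c 3 5) (c 4 5)
  intro i
  fin_cases i <;> tauto

/-- Opposite gaps are equal, so the gaps of half a turn add up to `m`. -/
theorem point_half (hσ : ∀ x, σ (σ x) = x) (hfix : ∀ x, σ x ≠ x)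
    (hφ : ∀ x, shiftPerm σ x ≠ x) {m : ℕ} (hN : N = 2 * m)
    (hM : (longSet (shiftPerm σ)).card = 4 ∨ (longSet (shiftPerm σ)).card = 6)
    {x : ZMod N} (hx : x ∈ longSet (shiftPerm σ)) :
    x + m ∈ longSet (shiftPerm σ) ∧
      shiftPerm σ x = x + m + gap (longSet (shiftPerm σ)) x := by
  set D := longSet (shiftPerm σ) with hD
  suffices h : ∃ i, point D x i = x + m ∧ gap D (point D x i) = gap D x ∧
      shiftPerm σ x = point D x (i + 1) by
    obtain ⟨i, h1, h2, h3⟩ := h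
    refine ⟨h1 ▸ point_mem hx i, ?_⟩
    rw [h3, point_succ, succPoint, h2, h1]
  have hsum := (sum_gap x hx).1
  rcases hM with hM | hM
  · obtain ⟨t, h1, h2, h3, h4, h5, h6⟩ := exists_index_involution hσ hfix hφ hM hx
    have ht := involution_fin_four t h1 h2 h3 h4
    have g0 := h5 0
    have g1 := h5 1
    have f0 := h6 0
    rw [ht] at g0 g1 f0
    rw [hM] at hsum
    simp only [Finset.sum_range_succ, Finset.sum_range_zero, ← hD] at hsum g0 g1 f0
    refine ⟨2, ?_, g0, f0⟩
    rw [point_eq]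
    simp only [Finset.sum_range_succ, Finset.sum_range_zero]
    congr 2
    change gap D (point D x 2) = gap D (point D x 0) at g0
    change gap D (point D x 3) = gap D (point D x 1) at g1
    omega
  · obtain ⟨t, h1, h2, h3, h4, h5, h6⟩ := exists_index_involution hσ hfix hφ hM hx
    have ht := involution_fin_six t h1 h2 h3 h4
    have g0 := h5 0
    have g1 := h5 1
    have g2 := h5 2
    have f0 := h6 0
    rw [ht] at g0 g1 g2 f0
    rw [hM] at hsum
    simp only [Finset.sum_range_succ, Finset.sum_range_zero, ← hD] at hsum g0 g1 g2 f0
    refine ⟨3, ?_, g0, f0⟩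
    rw [point_eq]
    simp only [Finset.sum_range_succ, Finset.sum_range_zero]
    congr 2
    change gap D (point D x 3) = gap D (point D x 0) at g0
    change gap D (point D x 4) = gap D (point D x 1) at g1
    change gap D (point D x 5) = gap D (point D x 2) at g2
    omega

end Forward

/-! ### The gluing defined by an antipodal set -/

section Backward

variable {N : ℕ} [NeZero N] {D : Finset (ZMod N)} {m : ℕ}

/-- The reversal of each interval between consecutive points of `D`, followed by the shift
by `m`. -/
noncomputable def reflFun (D : Finset (ZMod N)) (m : ℕ) (x : ZMod N) : ZMod N :=
  x + m + fwd D x + 1 - bwd D x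

/-- `D` is nonempty and invariant under the antipode `x ↦ x + m` of `ZMod (2 m)`. -/
structure IsSymmetric (D : Finset (ZMod N)) (m : ℕ) : Prop where
  eq_two_mul : N = 2 * m
  nonempty : D.Nonempty
  add_mem : ∀ x ∈ D, x + m ∈ D

theorem IsSymmetric.add_self (h : IsSymmetric D m) : (m : ZMod N) + m = 0 := by
  have : ((2 * m : ℕ) : ZMod N) = 0 := by rw [← h.eq_two_mul]; simp
  rw [← this]; push_cast; ring

theorem IsSymmetric.pos (h : IsSymmetric D m) : 0 < m := by
  have := h.eq_two_mul
  have := NeZero.pos N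
  omega

theorem IsSymmetric.add_mem_iff (h : IsSymmetric D m) {x : ZMod N} : x + m ∈ D ↔ x ∈ D := by
  refine ⟨fun hx => ?_, h.add_mem x⟩
  have := h.add_mem _ hx
  rwa [add_assoc, h.add_self, add_zero] at this

/-- The intervals contain their right end but not their left end, so reversal exchanges `fwd + 1`
and `bwd`; the antipode preserves both. -/
theorem IsSymmetric.fwd_bwd_reflFun (h : IsSymmetric D m) (x : ZMod N) :
    fwd D (reflFun D m x) = bwd D x - 1 ∧ bwd D (reflFun D m x) = fwd D x + 1 := by
  obtain ⟨h1, h2⟩ := bwd_spec h.nonempty x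
  have h3 := fwd_mem h.nonempty x
  apply fwd_bwd_eq (Nat.succ_pos _)
  · rw [← h.add_mem_iff] at h2
    convert h2 using 1
    unfold reflFun; push_cast; ring
  · rw [← h.add_mem_iff] at h3
    convert h3 using 1
    unfold reflFun
    rw [Nat.cast_sub h1]; push_cast; ring
  · intro j hj1 hj2 hmem
    refine notMem_of_between (D := D) x (fwd D x + 1 - bwd D x + j) (by push_cast at *; omega)
      (by omega) ?_
    rw [← h.add_mem_iff]
    convert hmem using 1
    unfold reflFun; push_cast; ring

theorem IsSymmetric.reflFun_reflFun (h : IsSymmetric D m) (x : ZMod N) :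
    reflFun D m (reflFun D m x) = x := by
  obtain ⟨h1, h2⟩ := h.fwd_bwd_reflFun x
  have h3 := (bwd_spec h.nonempty x).1
  have h4 := h.add_self
  rw [reflFun, h1, h2, reflFun, Nat.cast_sub h3]
  push_cast
  linear_combination h4

/-- The antipode of the left end of an interval is again in `D`, so no interval is longer than `m`.
This keeps the displacement of `reflPerm` strictly between `0` and `2 m`. -/
theorem IsSymmetric.fwd_add_bwd_le (h : IsSymmetric D m) (x : ZMod N) :
    fwd D x + bwd D x ≤ m := by
  have hm := h.pos
  by_contra hlt
  refine notMem_of_between (D := D) x (m - bwd D x) (by omega) (by omega) ?_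
  have := h.add_mem _ (bwd_spec h.nonempty x).2
  convert this using 1
  push_cast; ring

/-- The reflection of the intervals of a symmetric set, as a permutation. -/
noncomputable def IsSymmetric.reflPerm (h : IsSymmetric D m) : Perm (ZMod N) :=
  Function.Involutive.toPerm (reflFun D m) h.reflFun_reflFun

theorem IsSymmetric.reflPerm_apply (h : IsSymmetric D m) (x : ZMod N) :
    h.reflPerm x = x + m + fwd D x + 1 - bwd D x := rfl

theorem IsSymmetric.reflPerm_reflPerm (h : IsSymmetric D m) (x : ZMod N) :
    h.reflPerm (h.reflPerm x) = x := h.reflFun_reflFun x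

theorem IsSymmetric.natCast_ne_zero (h : IsSymmetric D m) {a : ℕ} (h0 : 0 < a) (h1 : a < 2 * m) :
    (a : ZMod N) ≠ 0 := by
  rw [Ne, ZMod.natCast_eq_zero_iff, h.eq_two_mul]
  exact fun hd => absurd (Nat.le_of_dvd h0 hd) (by omega)

theorem IsSymmetric.reflPerm_ne (h : IsSymmetric D m) (x : ZMod N) : h.reflPerm x ≠ x := by
  have h1 := h.fwd_add_bwd_le x
  have h2 := (bwd_spec h.nonempty x).1
  intro hx
  apply h.natCast_ne_zero (a := m + fwd D x + 1 - bwd D x) (by omega) (by omega)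
  rw [h.reflPerm_apply] at hx
  rw [Nat.cast_sub (by omega)]
  push_cast
  linear_combination hx

theorem fwd_pos {x : ZMod N} (hD : D.Nonempty) (hx : x ∉ D) : 0 < fwd D x := by
  rw [Nat.pos_iff_ne_zero]
  intro h0
  have := fwd_mem hD x
  rw [h0] at this
  exact hx (by simpa using this)

theorem bwd_add_one {x : ZMod N} (hx : x ∈ D) : bwd D (x + 1) = 1 :=
  le_antisymm (Nat.sInf_le (s := {t : ℕ | 1 ≤ t ∧ x + 1 - t ∈ D}) ⟨le_rfl, by simpa using hx⟩)
    (bwd_spec ⟨x, hx⟩ _).1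

theorem IsSymmetric.shiftPerm_of_mem (h : IsSymmetric D m) {x : ZMod N} (hx : x ∈ D) :
    shiftPerm h.reflPerm x = x + m + gap D x := by
  rw [shiftPerm_apply, h.reflPerm_apply, bwd_add_one hx, gap]
  push_cast; ring

theorem fwd_bwd_add_one (hD : D.Nonempty) {x : ZMod N} (hx : x ∉ D) :
    fwd D (x + 1) = fwd D x - 1 ∧ bwd D (x + 1) = bwd D x + 1 := by
  have h0 := fwd_pos hD hx
  apply fwd_bwd_eq (Nat.succ_pos _)
  · convert (bwd_spec hD x).2 using 1
    push_cast; ring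
  · convert fwd_mem hD x using 1
    rw [Nat.cast_sub h0]; push_cast; ring
  · intro j hj1 hj2 hmem
    refine notMem_of_between (D := D) x (j + 1) (by push_cast at *; omega) (by omega) ?_
    convert hmem using 1
    push_cast; ring

theorem IsSymmetric.reflPerm_add_one (h : IsSymmetric D m) {x : ZMod N} (hx : x ∉ D) :
    h.reflPerm (x + 1) = h.reflPerm x - 1 := by
  obtain ⟨h1, h2⟩ := fwd_bwd_add_one h.nonempty hx
  have h0 := fwd_pos h.nonempty hx
  rw [h.reflPerm_apply, h.reflPerm_apply, h1, h2, Nat.cast_sub h0]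
  push_cast; ring

theorem IsSymmetric.shiftPerm_shiftPerm_of_notMem (h : IsSymmetric D m) {x : ZMod N}
    (hx : x ∉ D) : shiftPerm h.reflPerm (shiftPerm h.reflPerm x) = x := by
  rw [shiftPerm_apply, shiftPerm_apply, h.reflPerm_add_one hx, sub_add_cancel,
    h.reflPerm_reflPerm]

theorem IsSymmetric.shiftPerm_ne_of_notMem (h : IsSymmetric D m) {x : ZMod N} (hx : x ∉ D) :
    shiftPerm h.reflPerm x ≠ x := by
  have h1 := h.fwd_add_bwd_le x
  have h2 := (bwd_spec h.nonempty x).1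
  have h0 := fwd_pos h.nonempty hx
  intro hx'
  rw [shiftPerm_apply, h.reflPerm_add_one hx] at hx'
  apply h.natCast_ne_zero (a := m + fwd D x - bwd D x) (by omega) (by omega)
  rw [h.reflPerm_apply] at hx'
  rw [Nat.cast_sub (by omega)]
  push_cast
  linear_combination hx'

theorem IsSymmetric.gap_add (h : IsSymmetric D m) (x : ZMod N) : gap D (x + m) = gap D x := by
  refine gap_eq (gap_pos x) ?_ fun j h1 h2 hj => ?_
  · have := succPoint_mem h.nonempty x
    rw [← h.add_mem_iff] at this
    convert this using 1
    unfold succPoint; ring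
  · refine notMem_of_lt_gap h1 h2 (D := D) (x := x) ?_
    rw [← h.add_mem_iff]
    convert hj using 1
    ring

theorem IsSymmetric.succPoint_add (h : IsSymmetric D m) (x : ZMod N) :
    succPoint D (x + m) = succPoint D x + m := by
  rw [succPoint, h.gap_add, succPoint]; ring

theorem IsSymmetric.point_add (h : IsSymmetric D m) (x : ZMod N) (i : ℕ) :
    point D (x + m) i = point D x i + m := by
  induction i with
  | zero => rfl
  | succ i ih => rw [point_succ, ih, h.succPoint_add, point_succ]

theorem point_point (x : ZMod N) (i j : ℕ) : point D (point D x i) j = point D x (i + j) := by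
  rw [add_comm]; exact (Function.iterate_add_apply _ _ _ _).symm

theorem point_eq_self_iff {x : ZMod N} (hx : x ∈ D) (i : ℕ) :
    point D x i = x ↔ D.card ∣ i := by
  have hpos : 0 < D.card := Finset.card_pos.2 ⟨x, hx⟩
  rw [Nat.dvd_iff_mod_eq_zero, ← point_mod_card hx i]
  constructor
  · intro h
    exact (sum_gap x hx).2.2 _ (Nat.mod_lt _ hpos) 0 hpos (by rw [h]; rfl)
  · intro h; rw [h]; rfl

/-- If `x + m` is the `j`-th point after `x`, then `2 j` steps return to `x`. So `c` divides `j`,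
and `0 < j < 2 c` leaves `j = c`. -/
theorem IsSymmetric.point_half (h : IsSymmetric D m) {x : ZMod N} (hx : x ∈ D) {c : ℕ}
    (hc : D.card = 2 * c) : point D x c = x + m := by
  obtain ⟨j, hj, hxj⟩ := (sum_gap x hx).2.1 _ (h.add_mem x hx)
  have h1 : point D x (j + j) = x := by
    rw [← point_point, hxj, h.point_add, hxj, add_assoc, h.add_self, add_zero]
  rw [point_eq_self_iff hx, hc] at h1
  have hj0 : j ≠ 0 := by
    rintro rfl
    have := h.natCast_ne_zero (a := m) h.pos (by have := h.pos; omega)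
    rw [point_zero] at hxj
    exact this (by simpa using hxj.symm)
  obtain ⟨q, hq⟩ := h1
  have : c ∣ j := ⟨q, by linarith⟩
  obtain ⟨q', rfl⟩ := this
  have hq' : q' < 2 := by
    by_contra hge
    have : c * 2 ≤ c * q' := Nat.mul_le_mul_left _ (by omega)
    omega
  have : q' ≠ 0 := by rintro rfl; simp at hj0
  obtain rfl : q' = 1 := by omega
  rw [← hxj, mul_one]

theorem IsSymmetric.shiftPerm_eq_point (h : IsSymmetric D m) {x : ZMod N} (hx : x ∈ D) {c : ℕ}
    (hc : D.card = 2 * c) : shiftPerm h.reflPerm x = point D x (c + 1) := by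
  rw [h.shiftPerm_of_mem hx, point_succ, h.point_half hx hc, succPoint, h.gap_add]

theorem IsSymmetric.longSet_eq (h : IsSymmetric D m) (hc : D.card = 4 ∨ D.card = 6) :
    longSet (shiftPerm h.reflPerm) = D := by
  ext x
  rw [mem_longSet]
  by_cases hx : x ∈ D
  · simp only [hx, iff_true]
    have key : ∀ c, D.card = 2 * c → ¬ 2 * c ∣ c + 1 + (c + 1) →
        shiftPerm h.reflPerm (shiftPerm h.reflPerm x) ≠ x := by
      intro c hc hnd
      rw [h.shiftPerm_eq_point hx hc, h.shiftPerm_eq_point (point_mem hx _) hc, point_point, Ne,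
        point_eq_self_iff hx, hc]
      exact hnd
    rcases hc with hc | hc
    · exact key 2 hc (by norm_num)
    · exact key 3 hc (by norm_num)
  · simp [hx, h.shiftPerm_shiftPerm_of_notMem hx]

theorem IsSymmetric.shiftPerm_ne (h : IsSymmetric D m) (hc : D.card = 4 ∨ D.card = 6)
    (x : ZMod N) : shiftPerm h.reflPerm x ≠ x := by
  by_cases hx : x ∈ D
  · intro hx'
    rw [← h.longSet_eq hc, mem_longSet, hx', hx'] at hx
    exact hx rfl
  · exact h.shiftPerm_ne_of_notMem hx

/-- On `D` the vertex permutation advances by `c + 1` of the `2 c` points: by 3 of 4, a single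
4-cycle, or by 4 of 6, two 3-cycles. -/
theorem IsSymmetric.cycleCount_shiftPerm (h : IsSymmetric D m) (hc : D.card = 4 ∨ D.card = 6) :
    cycleCount (shiftPerm h.reflPerm) + 1 = m := by
  have hl := h.longSet_eq hc
  have hX : Fintype.card (ZMod N) = 2 * m := by rw [ZMod.card, h.eq_two_mul]
  have hm : ∀ x, shiftPerm h.reflPerm (shiftPerm h.reflPerm x) ≠ x → x ∈ D := fun x hx => by
    rw [← hl, mem_longSet]; exact hx
  have hne := h.shiftPerm_ne hc
  have hl' : (univ.filter fun x => shiftPerm h.reflPerm (shiftPerm h.reflPerm x) ≠ x).card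
    = D.card := congrArg _ hl
  rcases hc with hc | hc
  · refine cycleCount_of_card_not_involutive (l := 4) hne hX (by norm_num) (by rw [hl', hc])
      fun x hx => ?_
    have e : ∀ y ∈ D, shiftPerm h.reflPerm y = point D y 3 := fun y hy =>
      h.shiftPerm_eq_point hy (c := 2) hc
    apply orbSize_eq_four hx
    have hx := hm x hx
    rw [e x hx, e _ (point_mem hx _), point_point, e _ (point_mem hx _), point_point,
      e _ (point_mem hx _), point_point, point_eq_self_iff hx, hc]
    norm_num
  · refine cycleCount_of_card_not_involutive (l := 3) hne hX (by norm_num) (by rw [hl', hc])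
      fun x hx => ?_
    have e : ∀ y ∈ D, shiftPerm h.reflPerm y = point D y 4 := fun y hy =>
      h.shiftPerm_eq_point hy (c := 3) hc
    apply orbSize_eq_three (hne x) hx
    have hx := hm x hx
    rw [e x hx, e _ (point_mem hx _), point_point, e _ (point_mem hx _), point_point,
      point_eq_self_iff hx, hc]
    norm_num

theorem gap_sub_bwd (hD : D.Nonempty) (x : ZMod N) :
    gap D (x - bwd D x) = fwd D x + bwd D x := by
  have h1 := (bwd_spec hD x).1
  refine gap_eq (by omega) ?_ fun j hj1 hj2 hj => ?_
  · convert fwd_mem hD x using 1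
    push_cast; ring
  · refine notMem_of_between (D := D) x (j - bwd D x) (by omega) (by omega) ?_
    convert hj using 1
    push_cast; ring

/-- The one-face maps of genus one on the `N`-gon all of whose vertices have degree at least two:
`σ` glues the sides in pairs, and the cycles of `shiftPerm σ` are the vertices. -/
structure IsTorusGluing (σ : Perm (ZMod N)) : Prop where
  involutive : ∀ x, σ (σ x) = x
  apply_ne : ∀ x, σ x ≠ x
  shiftPerm_ne : ∀ x, shiftPerm σ x ≠ x
  cycleCount : 2 * (cycleCount (shiftPerm σ) + 1) = N

theorem IsSymmetric.isTorusGluing (h : IsSymmetric D m) (hc : D.card = 4 ∨ D.card = 6) :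
    IsTorusGluing h.reflPerm :=
  ⟨h.reflPerm_reflPerm, h.reflPerm_ne, h.shiftPerm_ne hc, by
    rw [h.cycleCount_shiftPerm hc, h.eq_two_mul]⟩

theorem IsTorusGluing.card_longSet {σ : Perm (ZMod N)} (h : IsTorusGluing σ) :
    (longSet (shiftPerm σ)).card = 4 ∨ (longSet (shiftPerm σ)).card = 6 :=
  card_not_involutive h.shiftPerm_ne (by rw [ZMod.card, h.cycleCount]) rfl

theorem IsTorusGluing.isSymmetric {σ : Perm (ZMod N)} (h : IsTorusGluing σ) (hN : N = 2 * m) :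
    IsSymmetric (longSet (shiftPerm σ)) m where
  eq_two_mul := hN
  nonempty := Finset.card_pos.1 (by have := h.card_longSet; omega)
  add_mem _ hx :=
    (GenusOne.point_half h.involutive h.apply_ne h.shiftPerm_ne hN h.card_longSet hx).1

/-- By `point_half` the value at each long point is fixed by the long set, and `apply_add_of_lt_gap`
extends this to the interval after it. -/
theorem IsTorusGluing.eq_reflPerm {σ : Perm (ZMod N)} (h : IsTorusGluing σ) (hN : N = 2 * m) :
    σ = (h.isSymmetric hN).reflPerm := by
  ext1 x
  have hs := h.isSymmetric hN
  rw [hs.reflPerm_apply]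
  set D := longSet (shiftPerm σ) with hD
  obtain ⟨h1, h2⟩ := bwd_spec hs.nonempty x
  have hgap := gap_sub_bwd hs.nonempty x
  have h3 := apply_add_of_lt_gap h.involutive (x - bwd D x) (s := bwd D x - 1) (by
    rw [← hD, hgap]; omega)
  rw [(GenusOne.point_half h.involutive h.apply_ne h.shiftPerm_ne hN h.card_longSet h2).2,
    ← hD, hgap, Nat.cast_sub h1] at h3
  have e : x - bwd D x + 1 + ((bwd D x : ZMod N) - (1 : ℕ)) = x := by push_cast; ring
  rw [e] at h3
  rw [h3]
  push_cast; ring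

end Backward

/-! ### Counting antipodal sets -/

section SymmetricSets

variable {N : ℕ} [NeZero N] {m : ℕ}

/-- The points of `ZMod N` whose representative is congruent modulo `m` to an element of `E`. -/
def doubling (N : ℕ) [NeZero N] (m : ℕ) (E : Finset ℕ) : Finset (ZMod N) :=
  univ.filter fun x => x.val % m ∈ E

theorem mem_doubling {E : Finset ℕ} {x : ZMod N} : x ∈ doubling N m E ↔ x.val % m ∈ E := by
  simp [doubling]

theorem natCast_mem_doubling (hN : N = 2 * m) {E : Finset ℕ} {a : ℕ} :
    (a : ZMod N) ∈ doubling N m E ↔ a % m ∈ E := by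
  rw [mem_doubling, ZMod.val_natCast, Nat.mod_mod_of_dvd _ ⟨2, by rw [hN]; ring⟩]

theorem add_mem_doubling (hN : N = 2 * m) {E : Finset ℕ} {x : ZMod N} (hx : x ∈ doubling N m E) :
    x + m ∈ doubling N m E := by
  rw [mem_doubling] at hx
  have : x + m = ((x.val + m : ℕ) : ZMod N) := by simp
  rw [this, natCast_mem_doubling hN, Nat.add_mod_right]
  exact hx

theorem card_doubling (hN : N = 2 * m) {E : Finset ℕ} (hE : E ⊆ range m) :
    (doubling N m E).card = 2 * E.card := by
  have hm : 0 < m := by have := NeZero.pos N; omega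
  have hlt : ∀ p ∈ E, p < m := fun p hp => Finset.mem_range.1 (hE hp)
  have h : doubling N m E = E.image (fun p : ℕ => (p : ZMod N)) ∪
      E.image (fun p : ℕ => ((p + m : ℕ) : ZMod N)) := by
    ext x
    rw [mem_doubling, Finset.mem_union, Finset.mem_image, Finset.mem_image]
    have hx := x.val_lt
    constructor
    · intro h
      rcases Nat.lt_or_ge x.val m with h1 | h1
      · left
        rw [Nat.mod_eq_of_lt h1] at h
        exact ⟨_, h, by simp⟩
      · right
        rw [Nat.mod_eq_sub_mod h1, Nat.mod_eq_of_lt (by omega)] at h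
        exact ⟨_, h, by rw [Nat.sub_add_cancel h1]; simp⟩
    · rintro (⟨p, hp, rfl⟩ | ⟨p, hp, rfl⟩)
      · have := hlt p hp
        rw [← mem_doubling, natCast_mem_doubling hN, Nat.mod_eq_of_lt this]; exact hp
      · have := hlt p hp
        rw [← mem_doubling, natCast_mem_doubling hN, Nat.add_mod_right, Nat.mod_eq_of_lt this]
        exact hp
  have hinj : ∀ a < N, ∀ b < N, (a : ZMod N) = b → a = b := by
    intro a ha b hb hab
    rwa [ZMod.natCast_eq_natCast_iff', Nat.mod_eq_of_lt ha, Nat.mod_eq_of_lt hb] at hab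
  rw [h, Finset.card_union_of_disjoint, Finset.card_image_of_injOn, Finset.card_image_of_injOn]
  · ring
  · intro p hp q hq hpq
    have h1 := hlt p hp
    have h2 := hlt q hq
    have := hinj _ (by omega) _ (by omega) hpq
    omega
  · intro p hp q hq hpq
    have h1 := hlt p hp
    have h2 := hlt q hq
    exact hinj _ (by omega) _ (by omega) hpq
  · rw [Finset.disjoint_left]
    intro x hx hx'
    obtain ⟨p, hp, rfl⟩ := Finset.mem_image.1 hx
    obtain ⟨q, hq, hpq⟩ := Finset.mem_image.1 hx'
    have h1 := hlt p hp
    have h2 := hlt q hq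
    have := hinj _ (by omega) _ (by omega) hpq
    omega

theorem doubling_injOn (hN : N = 2 * m) {E F : Finset ℕ} (hE : E ⊆ range m) (hF : F ⊆ range m)
    (h : doubling N m E = doubling N m F) : E = F := by
  ext p
  by_cases hp : p < m
  · rw [← Nat.mod_eq_of_lt hp, ← natCast_mem_doubling hN, h, natCast_mem_doubling hN]
  · exact ⟨fun h => absurd (Finset.mem_range.1 (hE h)) hp,
      fun h => absurd (Finset.mem_range.1 (hF h)) hp⟩

theorem exists_eq_doubling (hN : N = 2 * m) {D : Finset (ZMod N)} (hD : ∀ x ∈ D, x + m ∈ D) :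
    ∃ E ⊆ range m, doubling N m E = D := by
  have hm : 0 < m := by have := NeZero.pos N; omega
  have h0 : ((m : ZMod N)) + m = 0 := by
    have : ((2 * m : ℕ) : ZMod N) = 0 := by rw [← hN]; simp
    rw [← this]; push_cast; ring
  refine ⟨(range m).filter fun p => (p : ZMod N) ∈ D, Finset.filter_subset _ _, ?_⟩
  ext x
  rw [mem_doubling, Finset.mem_filter, Finset.mem_range]
  have hx := x.val_lt
  have hxc : ((x.val : ℕ) : ZMod N) = x := by simp
  rcases Nat.lt_or_ge x.val m with h1 | h1
  · rw [Nat.mod_eq_of_lt h1, hxc]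
    exact and_iff_right h1
  · rw [Nat.mod_eq_sub_mod h1, Nat.mod_eq_of_lt (by omega), Nat.cast_sub h1, hxc]
    constructor
    · rintro ⟨-, h⟩
      simpa using hD _ h
    · intro h
      refine ⟨by omega, ?_⟩
      have := hD _ h
      rwa [show x - (m : ZMod N) = x + m by linear_combination -h0]

/-- The sets of vertices of degree above two that occur in the gluings of genus one. -/
def IsBranchSet (m : ℕ) (D : Finset (ZMod N)) : Prop :=
  (∀ x ∈ D, x + m ∈ D) ∧ (D.card = 4 ∨ D.card = 6)

theorem IsBranchSet.isSymmetric (hN : N = 2 * m) {D : Finset (ZMod N)} (h : IsBranchSet m D) :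
    IsSymmetric D m :=
  ⟨hN, Finset.card_pos.1 (by have := h.2; omega), h.1⟩

/-- The bijection sends a gluing to its long points. The predicates `P` and `Q` allow its
restriction to bipartite gluings. -/
theorem ncard_isTorusGluing (hN : N = 2 * m) (P : Perm (ZMod N) → Prop)
    (Q : Finset (ZMod N) → Prop)
    (hPQ : ∀ (D : Finset (ZMod N)) (h : IsSymmetric D m), P h.reflPerm ↔ Q D) :
    Set.ncard {σ : Perm (ZMod N) | IsTorusGluing σ ∧ P σ}
      = Set.ncard {D : Finset (ZMod N) | IsBranchSet m D ∧ Q D} := by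
  refine Set.ncard_congr (fun σ _ => longSet (shiftPerm σ)) ?_ ?_ ?_
  · rintro σ ⟨h, hP⟩
    have hs := h.isSymmetric hN
    refine ⟨⟨hs.add_mem, h.card_longSet⟩, (hPQ _ hs).1 ?_⟩
    rwa [← h.eq_reflPerm hN]
  · rintro σ τ ⟨h, -⟩ ⟨h', -⟩ he
    rw [h.eq_reflPerm hN, h'.eq_reflPerm hN]
    congr 1
  · rintro D ⟨h, hQ⟩
    have hs := h.isSymmetric hN
    exact ⟨hs.reflPerm, ⟨hs.isTorusGluing h.2, (hPQ _ hs).2 hQ⟩, hs.longSet_eq h.2⟩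

/-- Antipodal sets of 4 or 6 points are doublings of sets of 2 or 3 residues modulo `m`, and `C(m,
2) + C(m, 3) = C(m + 1, 3)`. -/
theorem ncard_isBranchSet (hN : N = 2 * m) :
    Set.ncard {D : Finset (ZMod N) | IsBranchSet m D} = (m + 1).choose 3 := by
  have h1 : ((range m).powersetCard 2 ∪ (range m).powersetCard 3).card = (m + 1).choose 3 := by
    rw [Finset.card_union_of_disjoint, Finset.card_powersetCard, Finset.card_powersetCard,
      Finset.card_range]
    · rfl
    · exact Finset.pairwise_disjoint_powersetCard _ (show 2 ≠ 3 by norm_num)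
  rw [← h1, ← Set.ncard_coe_finset]
  symm
  refine Set.ncard_congr (fun E _ => doubling N m E) ?_ ?_ ?_
  · intro E hE
    simp only [Finset.coe_union, Set.mem_union, Finset.mem_coe, Finset.mem_powersetCard] at hE
    refine ⟨fun x hx => add_mem_doubling hN hx, ?_⟩
    rw [card_doubling hN (hE.elim And.left And.left)]
    omega
  · intro E F hE hF h
    simp only [Finset.coe_union, Set.mem_union, Finset.mem_coe, Finset.mem_powersetCard] at hE hF
    exact doubling_injOn hN (hE.elim And.left And.left) (hF.elim And.left And.left) h
  · rintro D ⟨hD, hc⟩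
    obtain ⟨E, hE, rfl⟩ := exists_eq_doubling hN hD
    refine ⟨E, ?_, rfl⟩
    rw [card_doubling hN hE] at hc
    simp only [Finset.coe_union, Set.mem_union, Finset.mem_coe, Finset.mem_powersetCard]
    have : E.card = 2 ∨ E.card = 3 := by omega
    tauto

end SymmetricSets

/-! ### Primitive permutations without back points -/

section InvolutionCount

theorem exists_fin_equiv_zmod (N : ℕ) [NeZero N] :
    ∃ e : Fin N ≃ ZMod N, ∀ i, e (zeta N i) = e i + 1 := by
  cases N with
  | zero => exact absurd rfl (NeZero.ne 0)
  | succ n => exact ⟨Equiv.refl _, fun i => finRotate_apply i⟩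

/-- With `k` cycles on `2 k` points and no fixed point, `α` is an involution. Its dual is then `α *
zeta`, which is `shiftPerm α`, so primitivity says that `α` is a torus gluing of the `2 k`-gon. -/
theorem primCount_two_mul (k : ℕ) : primCount (2 * k) k = (k + 1).choose 3 := by
  rcases Nat.eq_zero_or_pos k with rfl | hk
  · have : {α : Perm (Fin (2 * 0)) | IsPrimitive α ∧ numCycles α = 0} = ∅ := by
      ext α
      simp only [Set.mem_ofPred_eq, Set.mem_empty_iff_false, iff_false]
      rintro ⟨h, -⟩
      exact absurd h.pos (by norm_num)
    rw [primCount, this, Set.ncard_empty]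
    rfl
  have : NeZero (2 * k) := ⟨by omega⟩
  obtain ⟨e, he⟩ := exists_fin_equiv_zmod (2 * k)
  have hshift : ∀ (α : Perm (Fin (2 * k))) (i : Fin (2 * k)),
      shiftPerm (e.permCongr α) (e i) = e ((α * zeta (2 * k) : Perm (Fin (2 * k))) i) := by
    intro α i
    rw [shiftPerm_apply, ← he, Equiv.permCongr_apply, Equiv.symm_apply_apply, Perm.mul_apply]
  have hcyc : ∀ α : Perm (Fin (2 * k)),
      cycleCount (shiftPerm (e.permCongr α)) = numCycles (α * zeta (2 * k)) := fun α =>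
    (cycleCount_congr _ _ e fun i => (hshift α i).symm).symm
  rw [← ncard_isBranchSet (N := 2 * k) rfl, primCount]
  have h2 := ncard_isTorusGluing (N := 2 * k) rfl (fun _ => True) (fun _ => True) (by simp)
  simp only [and_true] at h2
  rw [← h2]
  refine Set.ncard_congr (fun α _ => e.permCongr α) ?_ ?_ ?_
  · rintro α ⟨hα, hz⟩
    have hinv : ∀ i, α (α i) = i :=
      involutive_of_two_mul_cycleCount hα.2.1 (by
        rw [← numCycles_eq_cycleCount, hz, Fintype.card_fin])
    have hα' : α⁻¹ = α := by ext1 i; rw [Perm.inv_eq_iff_eq, hinv]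
    have hg := hα.1
    have hd := hα.2.2
    unfold HasGenus at hg
    rw [hα'] at hg hd
    refine ⟨?_, ?_, ?_, ?_⟩
    · intro x; simp [Equiv.permCongr_apply, hinv]
    · intro x hx
      apply hα.2.1 (e.symm x)
      rw [Equiv.permCongr_apply] at hx
      exact e.eq_symm_apply.2 hx
    · intro x hx
      obtain ⟨i, rfl⟩ := e.surjective x
      rw [hshift] at hx
      exact hd i (e.injective hx)
    · rw [hcyc]; omega
  · intro α γ _ _ h
    exact e.permCongr.injective h
  · intro σ hσ
    obtain ⟨α, rfl⟩ := e.permCongr.surjective σ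
    have hinv : ∀ i, α (α i) = i := fun i => by
      have := hσ.involutive (e i)
      simpa [Equiv.permCongr_apply] using this
    have hα' : α⁻¹ = α := by ext1 i; rw [Perm.inv_eq_iff_eq, hinv]
    have hne : ∀ i, α i ≠ i := fun i hi => by
      apply hσ.apply_ne (e i)
      simp [Equiv.permCongr_apply, hi]
    have hz : 2 * numCycles α = 2 * k := by
      rw [numCycles_eq_cycleCount, two_mul_cycleCount_of_involutive hne hinv, Fintype.card_fin]
    refine ⟨α, ⟨⟨?_, hne, ?_⟩, by omega⟩, rfl⟩
    · have := hσ.cycleCount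
      rw [hcyc] at this
      unfold HasGenus
      rw [hα']; omega
    · rw [hα']
      intro i hi
      apply hσ.shiftPerm_ne (e i)
      rw [hshift, hi]

end InvolutionCount

/-! ### Increasing triples of alternating parity -/

section Triples

theorem exists_sorted_of_card_eq_three {E : Finset ℕ} (h : E.card = 3) :
    ∃ p q r, p < q ∧ q < r ∧ E = {p, q, r} := by
  have hm := (E.orderEmbOfFin h).strictMono
  refine ⟨E.orderEmbOfFin h 0, E.orderEmbOfFin h 1, E.orderEmbOfFin h 2, hm (by decide),
    hm (by decide), ?_⟩
  rw [← Finset.coe_inj, ← Finset.range_orderEmbOfFin E h]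
  ext x
  simp only [Set.mem_range, Finset.coe_insert, Finset.coe_singleton, Set.mem_insert_iff,
    Set.mem_singleton_iff, Fin.exists_fin_succ, Fin.exists_fin_zero]
  simp [eq_comm]

theorem card_sorted {p q r : ℕ} (h1 : p < q) (h2 : q < r) : ({p, q, r} : Finset ℕ).card = 3 :=
  Finset.card_eq_three.2 ⟨p, q, r, by omega, by omega, by omega, rfl⟩

theorem sorted_inj {p q r p' q' r' : ℕ} (h1 : p < q) (h2 : q < r) (h1' : p' < q') (h2' : q' < r')
    (h : ({p, q, r} : Finset ℕ) = {p', q', r'}) : p = p' ∧ q = q' ∧ r = r' := by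
  have a := Finset.ext_iff.1 h
  have a1 := (a p).1 (by simp)
  have a2 := (a q).1 (by simp)
  have a3 := (a r).1 (by simp)
  have b1 := (a p').2 (by simp)
  have b3 := (a r').2 (by simp)
  simp only [Finset.mem_insert, Finset.mem_singleton] at a1 a2 a3 b1 b3
  omega

/-- The increasing triples of numbers below `n`. -/
def triples (n : ℕ) : Set (ℕ × ℕ × ℕ) := {t | t.1 < t.2.1 ∧ t.2.1 < t.2.2 ∧ t.2.2 < n}

theorem triples_finite (n : ℕ) : (triples n).Finite :=
  Set.Finite.subset (s := ↑((range n) ×ˢ (range n) ×ˢ (range n))) (Finset.finite_toSet _) (by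
    rintro ⟨p, q, r⟩ ⟨h1, h2, h3⟩
    simp only [Finset.coe_product, Set.mem_prod, Finset.mem_coe, Finset.mem_range] at *
    omega)

theorem ncard_triples (n : ℕ) : (triples n).ncard = n.choose 3 := by
  have h : ((range n).powersetCard 3).card = n.choose 3 := by
    rw [Finset.card_powersetCard, Finset.card_range]
  rw [← h, ← Set.ncard_coe_finset]
  refine Set.ncard_congr (fun t _ => {t.1, t.2.1, t.2.2}) ?_ ?_ ?_
  · rintro ⟨p, q, r⟩ ⟨h1, h2, h3⟩
    simp only at h1 h2 h3
    rw [Finset.mem_coe, Finset.mem_powersetCard]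
    refine ⟨?_, card_sorted h1 h2⟩
    intro x
    simp only [Finset.mem_insert, Finset.mem_singleton, Finset.mem_range]
    omega
  · rintro ⟨p, q, r⟩ ⟨p', q', r'⟩ ⟨h1, h2, -⟩ ⟨h1', h2', -⟩ h
    obtain ⟨rfl, rfl, rfl⟩ := sorted_inj h1 h2 h1' h2' h
    rfl
  · intro E hE
    rw [Finset.mem_coe, Finset.mem_powersetCard] at hE
    obtain ⟨p, q, r, h1, h2, rfl⟩ := exists_sorted_of_card_eq_three hE.2
    exact ⟨(p, q, r), ⟨h1, h2, Finset.mem_range.1 (hE.1 (by simp))⟩, rfl⟩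

/-- The increasing triples of numbers below `n` of alternating parity. -/
def alternatingTriples (n : ℕ) : Set (ℕ × ℕ × ℕ) :=
  {t | t ∈ triples n ∧ (t.2.1 - t.1) % 2 = 1 ∧ (t.2.2 - t.2.1) % 2 = 1}

/-- The two summands count the triples with even and with odd first entry. They have the form `(2 a,
2 b - 1, 2 c - 2)` and `(2 a + 1, 2 b, 2 c - 1)`, with `a < b < c` and `c` below `k + 2` and `k + 1`
respectively. -/
theorem ncard_alternatingTriples (k : ℕ) :
    (alternatingTriples (2 * k + 1)).ncard = (k + 2).choose 3 + (k + 1).choose 3 := by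
  rw [← ncard_triples, ← ncard_triples]
  have hfin : (alternatingTriples (2 * k + 1)).Finite :=
    (triples_finite (2 * k + 1)).subset fun _ h => h.1
  have hsplit : alternatingTriples (2 * k + 1) =
      {t ∈ alternatingTriples (2 * k + 1) | t.1 % 2 = 0} ∪
      {t ∈ alternatingTriples (2 * k + 1) | t.1 % 2 = 1} := by
    ext t
    simp only [Set.mem_union, Set.mem_ofPred_eq]
    have := Nat.mod_two_eq_zero_or_one t.1
    tauto
  rw [hsplit, Set.ncard_union_eq ?_ (hfin.subset fun _ h => h.1) (hfin.subset fun _ h => h.1)]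
  · congr 1
    · refine Set.ncard_congr (fun t _ => (t.1 / 2, t.2.1 / 2 + 1, t.2.2 / 2 + 1)) ?_ ?_ ?_
      · rintro ⟨p, q, r⟩ ⟨⟨⟨h1, h2, h3⟩, h4, h5⟩, h6⟩
        simp only [triples, Set.mem_ofPred_eq] at *
        omega
      · rintro ⟨p, q, r⟩ ⟨p', q', r'⟩ ⟨⟨⟨h1, h2, h3⟩, h4, h5⟩, h6⟩
          ⟨⟨⟨h1', h2', h3'⟩, h4', h5'⟩, h6'⟩ h
        simp only [Prod.mk.injEq] at *
        omega
      · rintro ⟨a, b, c⟩ ⟨h1, h2, h3⟩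
        simp only at h1 h2 h3
        refine ⟨(2 * a, 2 * b - 1, 2 * c - 2), ⟨⟨⟨?_, ?_, ?_⟩, ?_, ?_⟩, ?_⟩, ?_⟩ <;>
          simp only [Prod.mk.injEq] <;> omega
    · refine Set.ncard_congr (fun t _ => (t.1 / 2, t.2.1 / 2, t.2.2 / 2 + 1)) ?_ ?_ ?_
      · rintro ⟨p, q, r⟩ ⟨⟨⟨h1, h2, h3⟩, h4, h5⟩, h6⟩
        simp only [triples, Set.mem_ofPred_eq] at *
        omega
      · rintro ⟨p, q, r⟩ ⟨p', q', r'⟩ ⟨⟨⟨h1, h2, h3⟩, h4, h5⟩, h6⟩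
          ⟨⟨⟨h1', h2', h3'⟩, h4', h5'⟩, h6'⟩ h
        simp only [Prod.mk.injEq] at *
        omega
      · rintro ⟨a, b, c⟩ ⟨h1, h2, h3⟩
        simp only at h1 h2 h3
        refine ⟨(2 * a + 1, 2 * b, 2 * c - 1), ⟨⟨⟨?_, ?_, ?_⟩, ?_, ?_⟩, ?_⟩, ?_⟩ <;>
          simp only [Prod.mk.injEq] <;> omega
  · rw [Set.disjoint_left]
    rintro t ⟨-, h⟩ ⟨-, h'⟩
    omega

end Triples

/-! ### Parity-exchanging gluings and odd gaps -/

section OddGaps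

variable {N : ℕ} [NeZero N] {m : ℕ}

/-- For odd `m` the displacement at `x` has the parity of `fwd D x + bwd D x`, the length of the
interval containing `x`. Parity makes sense in `ZMod N` because `N` is even. -/
theorem IsSymmetric.swaps_parity_iff {D : Finset (ZMod N)} (h : IsSymmetric D m)
    (hm : m % 2 = 1) :
    (∀ x, (h.reflPerm x).val % 2 ≠ x.val % 2) ↔ ∀ d ∈ D, gap D d % 2 = 1 := by
  have hN := h.eq_two_mul
  have h1 : ∀ x, (h.reflPerm x).val % 2 = (x.val + m + fwd D x + 1 + bwd D x) % 2 := by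
    intro x
    have hb := h.fwd_add_bwd_le x
    have e : h.reflPerm x = ((x.val + m + fwd D x + 1 - bwd D x : ℕ) : ZMod N) := by
      rw [h.reflPerm_apply, Nat.cast_sub (by omega)]
      push_cast; simp
    rw [e, ZMod.val_natCast, Nat.mod_mod_of_dvd _ ⟨m, hN⟩]
    omega
  constructor
  · intro hs d hd
    have h2 := hs (d + 1)
    rw [h1, bwd_add_one hd] at h2
    unfold gap
    omega
  · intro hg x
    rw [h1]
    have h2 := (bwd_spec h.nonempty x)
    have hgap : gap D (x - bwd D x) = fwd D x + bwd D x := gap_sub_bwd h.nonempty x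
    have := hg _ h2.2
    omega

theorem gap_doubling (hN : N = 2 * m) {E : Finset ℕ} {p q : ℕ} (hpq : p < q) (hq : q % m ∈ E)
    (h : ∀ j, p < j → j < q → j % m ∉ E) : gap (doubling N m E) (p : ZMod N) = q - p := by
  refine gap_eq (by omega) ?_ fun j hj1 hj2 => ?_
  · rw [← Nat.cast_add, natCast_mem_doubling hN, show p + (q - p) = q by omega]
    exact hq
  · rw [← Nat.cast_add, natCast_mem_doubling hN]
    exact h _ (by omega) (by omega)

theorem forall_mem_doubling (hN : N = 2 * m) {E : Finset ℕ} (hE : E ⊆ range m)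
    (P : ℕ → Prop) :
    (∀ d ∈ doubling N m E, P (gap (doubling N m E) d)) ↔
      ∀ p ∈ E, P (gap (doubling N m E) (p : ZMod N)) := by
  have hm : 0 < m := by have := NeZero.pos N; omega
  constructor
  · intro h p hp
    refine h _ ?_
    rw [natCast_mem_doubling hN, Nat.mod_eq_of_lt (Finset.mem_range.1 (hE hp))]
    exact hp
  · intro h d hd
    have hmem := mem_doubling.1 hd
    have hs : IsSymmetric (doubling N m E) m := ⟨hN, ⟨d, hd⟩, fun x hx => add_mem_doubling hN hx⟩
    have hdv := d.val_lt
    have hdc : ((d.val : ℕ) : ZMod N) = d := by simp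
    have := h _ hmem
    rcases Nat.lt_or_ge d.val m with h1 | h1
    · rwa [Nat.mod_eq_of_lt h1, hdc] at this
    · rw [Nat.mod_eq_sub_mod h1, Nat.mod_eq_of_lt (by omega), Nat.cast_sub h1, hdc,
        ← hs.gap_add, sub_add_cancel] at this
      exact this

/-- The two gaps in half a turn add up to the odd number `m`, so they cannot both be odd. For three
gaps the same sum makes the third odd once the first two are. -/
theorem odd_gaps_pair (hN : N = 2 * m) (hm : m % 2 = 1) {p q : ℕ} (h1 : p < q) (h2 : q < m)
    (h : ∀ d ∈ doubling N m {p, q}, gap (doubling N m {p, q}) d % 2 = 1) : False := by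
  rw [forall_mem_doubling hN (P := fun n => n % 2 = 1) (by
    intro x; simp only [Finset.mem_insert, Finset.mem_singleton, Finset.mem_range]; omega)] at h
  have g1 : gap (doubling N m {p, q}) (p : ZMod N) = q - p := by
    refine gap_doubling hN h1 (by rw [Nat.mod_eq_of_lt h2]; simp) fun j hj1 hj2 => ?_
    rw [Nat.mod_eq_of_lt (by omega)]
    simp only [Finset.mem_insert, Finset.mem_singleton]; omega
  have g2 : gap (doubling N m {p, q}) (q : ZMod N) = p + m - q := by
    refine gap_doubling hN (by omega) (by rw [Nat.add_mod_right, Nat.mod_eq_of_lt (by omega)]; simp)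
      fun j hj1 hj2 => ?_
    simp only [Finset.mem_insert, Finset.mem_singleton]
    rcases Nat.lt_or_ge j m with h3 | h3
    · rw [Nat.mod_eq_of_lt h3]; omega
    · rw [Nat.mod_eq_sub_mod h3, Nat.mod_eq_of_lt (by omega)]; omega
  have e1 := h p (by simp)
  have e2 := h q (by simp)
  rw [g1] at e1
  rw [g2] at e2
  omega

theorem odd_gaps_triple (hN : N = 2 * m) (hm : m % 2 = 1) {p q r : ℕ} (h1 : p < q) (h2 : q < r)
    (h3 : r < m) :
    (∀ d ∈ doubling N m {p, q, r}, gap (doubling N m {p, q, r}) d % 2 = 1) ↔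
      (q - p) % 2 = 1 ∧ (r - q) % 2 = 1 := by
  rw [forall_mem_doubling hN (P := fun n => n % 2 = 1) (by
    intro x; simp only [Finset.mem_insert, Finset.mem_singleton, Finset.mem_range]; omega)]
  have g1 : gap (doubling N m {p, q, r}) (p : ZMod N) = q - p := by
    refine gap_doubling hN h1 (by rw [Nat.mod_eq_of_lt (by omega)]; simp) fun j hj1 hj2 => ?_
    rw [Nat.mod_eq_of_lt (by omega)]
    simp only [Finset.mem_insert, Finset.mem_singleton]; omega
  have g2 : gap (doubling N m {p, q, r}) (q : ZMod N) = r - q := by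
    refine gap_doubling hN h2 (by rw [Nat.mod_eq_of_lt h3]; simp) fun j hj1 hj2 => ?_
    rw [Nat.mod_eq_of_lt (by omega)]
    simp only [Finset.mem_insert, Finset.mem_singleton]; omega
  have g3 : gap (doubling N m {p, q, r}) (r : ZMod N) = p + m - r := by
    refine gap_doubling hN (by omega) (by rw [Nat.add_mod_right, Nat.mod_eq_of_lt (by omega)]; simp)
      fun j hj1 hj2 => ?_
    simp only [Finset.mem_insert, Finset.mem_singleton]
    rcases Nat.lt_or_ge j m with h3 | h3
    · rw [Nat.mod_eq_of_lt h3]; omega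
    · rw [Nat.mod_eq_sub_mod h3, Nat.mod_eq_of_lt (by omega)]; omega
  simp only [Finset.mem_insert, Finset.mem_singleton, forall_eq_or_imp, forall_eq, g1, g2, g3]
  omega

theorem ncard_isBranchSet_odd (hN : N = 2 * m) (hm : m % 2 = 1) :
    Set.ncard {D : Finset (ZMod N) | IsBranchSet m D ∧ ∀ d ∈ D, gap D d % 2 = 1}
      = (alternatingTriples m).ncard := by
  symm
  refine Set.ncard_congr (fun t _ => doubling N m {t.1, t.2.1, t.2.2}) ?_ ?_ ?_
  · rintro ⟨p, q, r⟩ ⟨⟨h1, h2, h3⟩, h4⟩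
    simp only at h1 h2 h3 h4
    refine ⟨⟨fun x hx => add_mem_doubling hN hx, ?_⟩, (odd_gaps_triple hN hm h1 h2 h3).2 h4⟩
    right
    rw [card_doubling hN, card_sorted h1 h2]
    intro x; simp only [Finset.mem_insert, Finset.mem_singleton, Finset.mem_range]; omega
  · rintro ⟨p, q, r⟩ ⟨p', q', r'⟩ ⟨⟨h1, h2, h3⟩, -⟩ ⟨⟨h1', h2', h3'⟩, -⟩ h
    simp only at h1 h2 h3 h1' h2' h3' h
    have := doubling_injOn hN (by
      intro x; simp only [Finset.mem_insert, Finset.mem_singleton, Finset.mem_range]; omega) (by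
      intro x; simp only [Finset.mem_insert, Finset.mem_singleton, Finset.mem_range]; omega) h
    obtain ⟨rfl, rfl, rfl⟩ := sorted_inj h1 h2 h1' h2' this
    rfl
  · rintro D ⟨⟨hD, hc⟩, hodd⟩
    obtain ⟨E, hE, rfl⟩ := exists_eq_doubling hN hD
    rw [card_doubling hN hE] at hc
    have hc' : E.card = 2 ∨ E.card = 3 := by omega
    rcases hc' with hc' | hc'
    · obtain ⟨p, q, hne, rfl⟩ := Finset.card_eq_two.1 hc'
      have hp := Finset.mem_range.1 (hE (show p ∈ _ by simp))
      have hq := Finset.mem_range.1 (hE (show q ∈ _ by simp))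
      rcases Nat.lt_or_gt_of_ne hne with hlt | hlt
      · exact (odd_gaps_pair hN hm hlt hq hodd).elim
      · rw [Finset.pair_comm] at hodd
        exact (odd_gaps_pair hN hm hlt hp hodd).elim
    · obtain ⟨p, q, r, h1, h2, rfl⟩ := exists_sorted_of_card_eq_three hc'
      have hr := Finset.mem_range.1 (hE (show r ∈ _ by simp))
      exact ⟨(p, q, r), ⟨⟨h1, h2, hr⟩, (odd_gaps_triple hN hm h1 h2 hr).1 hodd⟩, rfl⟩

end OddGaps

/-! ### Primitive permutations with one back point -/

section OddCount

variable {m : ℕ}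

/-- The sides of the `2 m`-gon: `2 i` for `inl i` and `2 i + 1` for `inr i`. -/
def sideVal : Fin m ⊕ Fin m → ℕ := Sum.elim (fun i => 2 * i) (fun i => 2 * i + 1)

theorem sideVal_lt (s : Fin m ⊕ Fin m) : sideVal s < 2 * m := by
  rcases s with i | i <;> simp only [sideVal, Sum.elim_inl, Sum.elim_inr] <;> omega

theorem sideVal_injective : Function.Injective (sideVal (m := m)) := by
  rintro (i | i) (j | j) h <;> simp only [sideVal, Sum.elim_inl, Sum.elim_inr] at h
  · rw [Fin.ext (show (i : ℕ) = j by omega)]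
  · omega
  · omega
  · rw [Fin.ext (show (i : ℕ) = j by omega)]

theorem natCast_sideVal_bijective [NeZero (2 * m)] :
    Function.Bijective fun s : Fin m ⊕ Fin m => (sideVal s : ZMod (2 * m)) := by
  rw [Fintype.bijective_iff_injective_and_card]
  constructor
  · intro s t h
    simp only [ZMod.natCast_eq_natCast_iff', Nat.mod_eq_of_lt (sideVal_lt _)] at h
    exact sideVal_injective h
  · rw [Fintype.card_sum, Fintype.card_fin, ZMod.card]; ring

/-- The bijection of the sides of the `2 m`-gon with `ZMod (2 m)`. -/
noncomputable def sideEquiv (m : ℕ) [NeZero (2 * m)] : Fin m ⊕ Fin m ≃ ZMod (2 * m) :=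
  Equiv.ofBijective _ natCast_sideVal_bijective

variable [NeZero (2 * m)]

theorem val_sideEquiv (s : Fin m ⊕ Fin m) : (sideEquiv m s).val = sideVal s := by
  change ((sideVal s : ZMod (2 * m))).val = _
  rw [ZMod.val_natCast, Nat.mod_eq_of_lt (sideVal_lt s)]

theorem sideEquiv_inl_add_one (i : Fin m) :
    sideEquiv m (Sum.inl i) + 1 = sideEquiv m (Sum.inr i) := by
  change ((2 * i : ℕ) : ZMod (2 * m)) + 1 = ((2 * i + 1 : ℕ) : ZMod (2 * m))
  push_cast; rfl

theorem sideEquiv_inr_add_one (i : Fin m) :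
    sideEquiv m (Sum.inr i) + 1 = sideEquiv m (Sum.inl (zeta m i)) := by
  change ((2 * i + 1 : ℕ) : ZMod (2 * m)) + 1 = ((2 * zeta m i : ℕ) : ZMod (2 * m))
  rw [val_zeta]
  split_ifs with h
  · push_cast; ring
  · have h1 : ((2 * m : ℕ) : ZMod (2 * m)) = 0 := by simp
    rw [← show (i : ℕ) + 1 = m by omega] at h1
    rw [mul_zero, Nat.cast_zero]
    rw [← CharP.cast_eq_zero (ZMod (2 * m)) (2 * m), ← Nat.cast_add_one]
    congr 1
    omega

/-- The gluing of the sides of the `2 m`-gon that makes `α` and its dual the two kinds of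
vertices. -/
def gluing (α : Perm (Fin m)) : Perm (Fin m ⊕ Fin m) where
  toFun := Sum.elim (fun i => Sum.inr (α⁻¹ i)) (fun i => Sum.inl (α i))
  invFun := Sum.elim (fun i => Sum.inr (α⁻¹ i)) (fun i => Sum.inl (α i))
  left_inv := by rintro (i | i) <;> simp
  right_inv := by rintro (i | i) <;> simp

theorem gluing_inl (α : Perm (Fin m)) (i : Fin m) :
    gluing α (Sum.inl i) = Sum.inr (α⁻¹ i) := rfl

theorem gluing_inr (α : Perm (Fin m)) (i : Fin m) : gluing α (Sum.inr i) = Sum.inl (α i) := rfl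

theorem shiftPerm_gluing (α : Perm (Fin m)) (s : Fin m ⊕ Fin m) :
    shiftPerm ((sideEquiv m).permCongr (gluing α)) (sideEquiv m s)
      = sideEquiv m (Equiv.sumCongr α (α⁻¹ * zeta m) s) := by
  rw [shiftPerm_apply, Equiv.permCongr_apply]
  rcases s with i | i
  · rw [sideEquiv_inl_add_one, Equiv.symm_apply_apply]; rfl
  · rw [sideEquiv_inr_add_one, Equiv.symm_apply_apply]; rfl

/-- The vertex permutation acts as `α` on the even sides and as the dual of `α` on the odd sides, so
its cycle count is the sum that defines the genus. -/
theorem isTorusGluing_gluing_iff (α : Perm (Fin m)) :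
    IsTorusGluing ((sideEquiv m).permCongr (gluing α)) ↔ IsPrimitive α := by
  have hc : cycleCount (shiftPerm ((sideEquiv m).permCongr (gluing α)))
      = numCycles α + numCycles (α⁻¹ * zeta m) := by
    rw [numCycles_eq_cycleCount, numCycles_eq_cycleCount, ← cycleCount_sumCongr]
    exact (cycleCount_congr _ _ (sideEquiv m) fun s => (shiftPerm_gluing α s).symm).symm
  have hne : (∀ x, shiftPerm ((sideEquiv m).permCongr (gluing α)) x ≠ x) ↔
      (∀ i, α i ≠ i) ∧ ∀ i, (α⁻¹ * zeta m) i ≠ i := by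
    rw [(sideEquiv m).surjective.forall]
    simp only [shiftPerm_gluing, (sideEquiv m).injective.ne_iff, Sum.forall]
    simp
  constructor
  · intro h
    have h1 := h.cycleCount
    rw [hc] at h1
    refine ⟨?_, hne.1 h.shiftPerm_ne⟩
    unfold HasGenus
    omega
  · rintro ⟨h1, h2⟩
    unfold HasGenus at h1
    refine ⟨?_, ?_, hne.2 h2, by rw [hc]; omega⟩
    · rw [(sideEquiv m).surjective.forall]
      rintro (i | i) <;> simp [Equiv.permCongr_apply, gluing_inl, gluing_inr]
    · rw [(sideEquiv m).surjective.forall]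
      rintro (i | i) <;> simp [Equiv.permCongr_apply, gluing_inl, gluing_inr]

theorem val_gluing_ne (α : Perm (Fin m)) (x : ZMod (2 * m)) :
    ((sideEquiv m).permCongr (gluing α) x).val % 2 ≠ x.val % 2 := by
  obtain ⟨s, rfl⟩ := (sideEquiv m).surjective x
  rw [Equiv.permCongr_apply, Equiv.symm_apply_apply, val_sideEquiv, val_sideEquiv]
  rcases s with i | i
  · rw [gluing_inl]; simp only [sideVal, Sum.elim_inl, Sum.elim_inr]; omega
  · rw [gluing_inr]; simp only [sideVal, Sum.elim_inl, Sum.elim_inr]; omega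

theorem exists_eq_gluing {σ : Perm (ZMod (2 * m))} (hσ : ∀ x, σ (σ x) = x)
    (hp : ∀ x, (σ x).val % 2 ≠ x.val % 2) :
    ∃ α : Perm (Fin m), (sideEquiv m).permCongr (gluing α) = σ := by
  have hl : ∀ i, ∃ j, σ (sideEquiv m (Sum.inl i)) = sideEquiv m (Sum.inr j) := by
    intro i
    obtain ⟨s, hs⟩ := (sideEquiv m).surjective (σ (sideEquiv m (Sum.inl i)))
    have := hp (sideEquiv m (Sum.inl i))
    rw [← hs, val_sideEquiv, val_sideEquiv] at this
    rcases s with j | j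
    · simp only [sideVal, Sum.elim_inl] at this; omega
    · exact ⟨j, hs.symm⟩
  have hr : ∀ i, ∃ j, σ (sideEquiv m (Sum.inr i)) = sideEquiv m (Sum.inl j) := by
    intro i
    obtain ⟨s, hs⟩ := (sideEquiv m).surjective (σ (sideEquiv m (Sum.inr i)))
    have := hp (sideEquiv m (Sum.inr i))
    rw [← hs, val_sideEquiv, val_sideEquiv] at this
    rcases s with j | j
    · exact ⟨j, hs.symm⟩
    · simp only [sideVal, Sum.elim_inr] at this; omega
  choose b hb using hl
  choose a ha using hr
  have hab : ∀ i, a (b i) = i := fun i => by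
    have := hσ (sideEquiv m (Sum.inl i))
    rw [hb, ha] at this
    exact Sum.inl_injective ((sideEquiv m).injective this)
  have hba : ∀ i, b (a i) = i := fun i => by
    have := hσ (sideEquiv m (Sum.inr i))
    rw [ha, hb] at this
    exact Sum.inr_injective ((sideEquiv m).injective this)
  refine ⟨⟨a, b, hba, hab⟩, ?_⟩
  ext1 x
  obtain ⟨s, rfl⟩ := (sideEquiv m).surjective x
  rw [Equiv.permCongr_apply, Equiv.symm_apply_apply]
  rcases s with i | i
  · rw [hb]; rfl
  · rw [ha]; rfl

theorem primCount_two_mul_add_one (k : ℕ) :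
    primCount (2 * k + 1) k = (k + 2).choose 3 + (k + 1).choose 3 := by
  have : NeZero (2 * (2 * k + 1)) := ⟨by omega⟩
  have hm : (2 * k + 1) % 2 = 1 := by omega
  rw [← ncard_alternatingTriples, ← ncard_isBranchSet_odd (N := 2 * (2 * k + 1)) rfl hm,
    ← ncard_isTorusGluing rfl (fun σ => ∀ x, (σ x).val % 2 ≠ x.val % 2) _
      fun D h => h.swaps_parity_iff hm]
  refine Set.ncard_congr (fun α _ => (sideEquiv (2 * k + 1)).permCongr (gluing α)) ?_ ?_ ?_
  · rintro α ⟨h, -⟩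
    exact ⟨(isTorusGluing_gluing_iff α).2 h, val_gluing_ne α⟩
  · intro α γ _ _ h
    ext1 i
    have := congrArg (fun π : Perm (Fin (2 * k + 1) ⊕ Fin (2 * k + 1)) => π (Sum.inr i))
      ((sideEquiv (2 * k + 1)).permCongr.injective h)
    exact Sum.inl_injective this
  · rintro σ ⟨h, hp⟩
    obtain ⟨α, rfl⟩ := exists_eq_gluing h.involutive hp
    have hα := (isTorusGluing_gluing_iff α).1 h
    refine ⟨α, ⟨hα, ?_⟩, rfl⟩
    -- The number of cycles need not be imposed: `α` and its dual have at most `k` cycles each and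
    -- `2 k` together.
    have h1 := two_mul_cycleCount_le hα.2.1
    have h2 := two_mul_cycleCount_le hα.2.2
    have h3 := hα.1
    unfold HasGenus at h3
    rw [← numCycles_eq_cycleCount, Fintype.card_fin] at h1 h2
    omega

end OddCount

/-! ### Closed formulas -/

section Formulas

theorem primCount_two_mul_add_two (k : ℕ) : primCount (2 * k + 2) k = (k + 2).choose 3 := by
  rw [primCount_dual (l := k + 1) (by omega), show 2 * k + 2 = 2 * (k + 1) by ring,
    primCount_two_mul]

theorem r_zero (n k : ℕ) : r 0 n k = n.choose (2 * k) * (k + 1).choose 3 := by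
  rw [r_eq, add_zero, primCount_two_mul]

theorem r_one (n k : ℕ) :
    r 1 n k = n.choose (2 * k + 1) * ((k + 2).choose 3 + (k + 1).choose 3) := by
  rw [r_eq, primCount_two_mul_add_one]

theorem r_two (n k : ℕ) : r 2 n k = n.choose (2 * k + 2) * (k + 2).choose 3 := by
  rw [r_eq, primCount_two_mul_add_two]

theorem rStar_formula (n k : ℕ) :
    rStar n k = (n + 2).choose (2 * k + 2) * (k + 1).choose 3
      + (n + 1).choose (2 * k + 2) * (k + 1).choose 2 := by
  rw [rStar_eq, r_zero, r_one, r_two]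
  have h1 : (n + 2).choose (2 * k + 2) = (n + 1).choose (2 * k + 1) + (n + 1).choose (2 * k + 2) :=
    Nat.choose_succ_succ _ _
  have h2 : (n + 1).choose (2 * k + 1) = n.choose (2 * k) + n.choose (2 * k + 1) :=
    Nat.choose_succ_succ _ _
  have h3 : (n + 1).choose (2 * k + 2) = n.choose (2 * k + 1) + n.choose (2 * k + 2) :=
    Nat.choose_succ_succ _ _
  have h4 : (k + 2).choose 3 = (k + 1).choose 2 + (k + 1).choose 3 := Nat.choose_succ_succ _ _
  rw [h1, h2, h3, h4]
  ring

end Formulas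

/-! ### Generating functions -/

section GeneratingFunctions

open MvPowerSeries

/-- The formal power series `∑ c(n, k) x ^ n y ^ k` with rational coefficients. -/
noncomputable def ratGenFun (c : ℕ → ℕ → ℚ) : MvPowerSeries (Fin 2) ℚ := fun m => c (m 0) (m 1)

theorem coeff_ratGenFun (c : ℕ → ℕ → ℚ) (m : Fin 2 →₀ ℕ) :
    coeff m (ratGenFun c) = c (m 0) (m 1) := rfl

theorem coeff_x_mul (f : MvPowerSeries (Fin 2) ℚ) (m : Fin 2 →₀ ℕ) :
    coeff m (x * f) = if m 0 = 0 then 0 else coeff (m - Finsupp.single 0 1) f := by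
  rw [x, X, coeff_monomial_mul, one_mul]
  have : Finsupp.single (0 : Fin 2) 1 ≤ m ↔ ¬ m 0 = 0 := by
    rw [Finsupp.single_le_iff, Nat.one_le_iff_ne_zero]
  by_cases h : m 0 = 0
  · rw [if_neg (by rw [this]; simpa using h), if_pos h]
  · rw [if_pos (this.2 h), if_neg h]

theorem coeff_y_mul (f : MvPowerSeries (Fin 2) ℚ) (m : Fin 2 →₀ ℕ) :
    coeff m (y * f) = if m 1 = 0 then 0 else coeff (m - Finsupp.single 1 1) f := by
  rw [y, X, coeff_monomial_mul, one_mul]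
  have : Finsupp.single (1 : Fin 2) 1 ≤ m ↔ ¬ m 1 = 0 := by
    rw [Finsupp.single_le_iff, Nat.one_le_iff_ne_zero]
  by_cases h : m 1 = 0
  · rw [if_neg (by rw [this]; simpa using h), if_pos h]
  · rw [if_pos (this.2 h), if_neg h]

/-- The series `∑ C(n, 2 k + i) q(k) x ^ n y ^ k`. -/
noncomputable def chooseSeries (i : ℕ) (q : ℕ → ℚ) : MvPowerSeries (Fin 2) ℚ :=
  ratGenFun fun n k => (n.choose (2 * k + i) : ℚ) * q k

/-- This is Pascal's rule in `n`. -/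
theorem one_sub_x_mul_chooseSeries (i : ℕ) (q : ℕ → ℚ) :
    (1 - x) * chooseSeries (i + 1) q = x * chooseSeries i q := by
  ext m
  rw [sub_mul, one_mul, map_sub, coeff_x_mul, coeff_x_mul, chooseSeries, chooseSeries]
  simp only [coeff_ratGenFun, Finsupp.tsub_apply]
  obtain h | ⟨n, h⟩ : m 0 = 0 ∨ ∃ n, m 0 = n + 1 := by
    cases m 0 with
    | zero => exact Or.inl rfl
    | succ n => exact Or.inr ⟨n, rfl⟩
  · simp [h, Nat.choose_eq_zero_of_lt (show 0 < 2 * m 1 + (i + 1) by omega)]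
  · simp only [h, ← add_assoc, Nat.choose_succ_succ']
    simp
    ring

/-- Splitting off `k = 0` and shifting `k` turns `2 k` into `2 k + 2`. -/
theorem chooseSeries_zero (q : ℕ → ℚ) :
    chooseSeries 0 q = q 0 • ratGenFun (fun _ k => if k = 0 then 1 else 0)
      + y * chooseSeries 2 fun k => q (k + 1) := by
  ext m
  rw [map_add, map_smul, coeff_y_mul, chooseSeries, chooseSeries]
  simp only [coeff_ratGenFun, Finsupp.tsub_apply]
  obtain h | ⟨k, h⟩ : m 1 = 0 ∨ ∃ n, m 1 = n + 1 := by
    cases m 1 with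
    | zero => exact Or.inl rfl
    | succ n => exact Or.inr ⟨n, rfl⟩
  · simp [h]
  · simp [h, mul_add]

theorem one_sub_x_mul_geometric :
    (1 - x) * ratGenFun (fun _ k => if k = 0 then 1 else 0) = 1 := by
  ext m
  rw [sub_mul, one_mul, map_sub, coeff_x_mul, coeff_one]
  simp only [coeff_ratGenFun, Finsupp.tsub_apply]
  have hm : m = 0 ↔ m 0 = 0 ∧ m 1 = 0 := by
    rw [Finsupp.ext_iff, Fin.forall_fin_two]; simp
  by_cases h0 : m 0 = 0 <;> by_cases h1 : m 1 = 0 <;> simp [hm, h0, h1]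

theorem chooseSeries_add (i : ℕ) (p q : ℕ → ℚ) :
    chooseSeries i (fun k => p k + q k) = chooseSeries i p + chooseSeries i q := by
  ext m
  simp only [chooseSeries, map_add, coeff_ratGenFun]
  ring

/-- Each multiplication by the denominator replaces `q` by its difference sequence `d`, so a
polynomial `q` is exhausted after finitely many steps. -/
theorem denominator_mul_chooseSeries (q d : ℕ → ℚ) (h : ∀ k, q (k + 1) = q k + d k) :
    ((1 - x) ^ 2 - y * x ^ 2) * chooseSeries 0 q
      = q 0 • (1 - x) + y * x ^ 2 * chooseSeries 0 d := by
  have h1 := chooseSeries_zero q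
  have h2 := one_sub_x_mul_chooseSeries 1 fun k => q (k + 1)
  have h3 := one_sub_x_mul_chooseSeries 0 fun k => q (k + 1)
  have h4 : chooseSeries 0 (fun k => q (k + 1)) = chooseSeries 0 q + chooseSeries 0 d := by
    rw [← chooseSeries_add]
    congr 1
    exact funext h
  have h5 := one_sub_x_mul_geometric
  rw [h4] at h3
  rw [MvPowerSeries.smul_eq_C_mul] at h1 ⊢
  linear_combination (1 - x) ^ 2 * h1 + y * (1 - x) * h2 + y * x * h3
    + (1 - x) * C (q 0) * h5

theorem genFun_eq_chooseSeries {a : ℕ → ℕ → ℕ} {i : ℕ} {q : ℕ → ℚ}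
    (h : ∀ n k, (a n k : ℚ) = (n.choose (2 * k + i) : ℚ) * q k) : genFun a = chooseSeries i q :=
  funext fun m => h (m 0) (m 1)

theorem denominator_pow_mul_chooseSeries :
    ((1 - x) ^ 2 - y * x ^ 2) ^ 3 * chooseSeries 0 (fun k => ((k + 1).choose 2 : ℚ))
        = y * x ^ 2 * (1 - x) ^ 3 ∧
      ((1 - x) ^ 2 - y * x ^ 2) ^ 4 * chooseSeries 0 (fun k => ((k + 1).choose 3 : ℚ))
        = y ^ 2 * x ^ 4 * (1 - x) ^ 3 := by
  -- The successive differences of `C(k + 1, 3)` are `C(k + 1, 2)`, `C(k + 1, 1)`, `1` and `0`.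
  have a3 := denominator_mul_chooseSeries (fun k => ((k + 1).choose 3 : ℚ))
    (fun k => ((k + 1).choose 2 : ℚ)) fun k => by
      rw [Nat.choose_succ_succ' (k + 1) 2]; push_cast; ring
  have a2 := denominator_mul_chooseSeries (fun k => ((k + 1).choose 2 : ℚ))
    (fun k => ((k + 1).choose 1 : ℚ)) fun k => by
      rw [Nat.choose_succ_succ' (k + 1) 1]; push_cast; ring
  have a1 := denominator_mul_chooseSeries (fun k => ((k + 1).choose 1 : ℚ))
    (fun _ => 1) fun k => by simp
  have a0 := denominator_mul_chooseSeries (fun _ => 1) (fun _ => 0) fun k => by simp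
  have z : chooseSeries 0 (fun _ => 0) = 0 := by
    ext m; simp [chooseSeries, coeff_ratGenFun]
  rw [z] at a0
  simp [show Nat.choose 1 3 = 0 from rfl] at a0 a1 a2 a3
  set Δ := (1 - x) ^ 2 - y * x ^ 2 with hΔ
  have b2 : Δ ^ 3 * chooseSeries 0 (fun k => ((k + 1).choose 2 : ℚ))
      = y * x ^ 2 * (1 - x) ^ 3 := by
    linear_combination Δ ^ 2 * a2 + Δ * y * x ^ 2 * a1 + (y * x ^ 2) ^ 2 * a0
      + y * x ^ 2 * (1 - x) * hΔ
  exact ⟨b2, by linear_combination Δ ^ 3 * a3 + y * x ^ 2 * b2⟩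

theorem constantCoeff_denominator :
    constantCoeff (((1 - x) ^ 2 - y * x ^ 2) ^ 4 : MvPowerSeries (Fin 2) ℚ) ≠ 0 := by
  simp [x, y]

theorem one_sub_x_ne_zero : (1 - x : MvPowerSeries (Fin 2) ℚ) ≠ 0 := fun h => by
  have := congrArg constantCoeff h
  simp [x] at this

theorem genFun_r_zero :
    genFun (r 0) = y ^ 2 * x ^ 4 * (1 - x) ^ 3 * (((1 - x) ^ 2 - y * x ^ 2) ^ 4)⁻¹ := by
  rw [MvPowerSeries.eq_mul_inv_iff_mul_eq constantCoeff_denominator,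
    genFun_eq_chooseSeries (i := 0) (q := fun k => ((k + 1).choose 3 : ℚ))
      fun n k => by rw [r_zero]; push_cast; rfl]
  rw [mul_comm]
  exact denominator_pow_mul_chooseSeries.2

theorem genFun_r_one :
    genFun (r 1) = y * x ^ 3 * (1 - x) ^ 2 * ((1 - x) ^ 2 + y * x ^ 2)
        * (((1 - x) ^ 2 - y * x ^ 2) ^ 4)⁻¹ := by
  rw [MvPowerSeries.eq_mul_inv_iff_mul_eq constantCoeff_denominator,
    genFun_eq_chooseSeries (i := 1)
      (q := fun k => ((k + 1).choose 2 : ℚ) + (((k + 1).choose 3 : ℚ) + ((k + 1).choose 3 : ℚ)))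
      fun n k => by
        rw [r_one, Nat.choose_succ_succ' (k + 1) 2]; push_cast; ring]
  obtain ⟨h2, h3⟩ := denominator_pow_mul_chooseSeries
  have h1 := one_sub_x_mul_chooseSeries 0
    fun k => ((k + 1).choose 2 : ℚ) + (((k + 1).choose 3 : ℚ) + ((k + 1).choose 3 : ℚ))
  rw [chooseSeries_add 0, chooseSeries_add 0] at h1
  -- The factor `1 - x` is what lowers the index `1` of the series to `0`.
  apply mul_left_cancel₀ one_sub_x_ne_zero
  linear_combination ((1 - x) ^ 2 - y * x ^ 2) ^ 4 * h1 + x * ((1 - x) ^ 2 - y * x ^ 2) * h2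
    + 2 * x * h3

theorem genFun_r_two :
    genFun (r 2) = y * x ^ 4 * (1 - x) ^ 3 * (((1 - x) ^ 2 - y * x ^ 2) ^ 4)⁻¹ := by
  rw [MvPowerSeries.eq_mul_inv_iff_mul_eq constantCoeff_denominator,
    genFun_eq_chooseSeries (i := 2)
      (q := fun k => ((k + 1).choose 2 : ℚ) + ((k + 1).choose 3 : ℚ))
      fun n k => by
        rw [r_two, Nat.choose_succ_succ' (k + 1) 2]; push_cast; ring]
  obtain ⟨h2, h3⟩ := denominator_pow_mul_chooseSeries
  have h1 := one_sub_x_mul_chooseSeries 0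
    fun k => ((k + 1).choose 2 : ℚ) + ((k + 1).choose 3 : ℚ)
  have h0 := one_sub_x_mul_chooseSeries 1
    fun k => ((k + 1).choose 2 : ℚ) + ((k + 1).choose 3 : ℚ)
  rw [chooseSeries_add 0] at h1
  apply mul_left_cancel₀ (pow_ne_zero 2 one_sub_x_ne_zero)
  linear_combination ((1 - x) ^ 2 - y * x ^ 2) ^ 4 * ((1 - x) * h0 + x * h1)
    + x ^ 2 * ((1 - x) ^ 2 - y * x ^ 2) * h2 + x ^ 2 * h3

theorem genFun_rStar :
    genFun rStar
      = y * x ^ 3 * (1 - x) ^ 2 * (1 - x + x * y) * (((1 - x) ^ 2 - y * x ^ 2) ^ 4)⁻¹ := by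
  have h : genFun rStar = genFun (r 0) + genFun (r 1) + genFun (r 2) := by
    funext m
    change ((rStar _ _ : ℕ) : ℚ) = (r 0 _ _ : ℚ) + (r 1 _ _ : ℚ) + (r 2 _ _ : ℚ)
    rw [rStar_eq]; push_cast; rfl
  rw [h, genFun_r_zero, genFun_r_one, genFun_r_two]
  ring

end GeneratingFunctions

end GenusOne

open GenusOne
theorem theorem3p2 :
    (∀ n k : ℕ,
      rStar n k = (n + 2).choose (2 * k + 2) * (k + 1).choose 3
        + (n + 1).choose (2 * k + 2) * (k + 1).choose 2) ∧
    (∀ n k : ℕ,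
      r 0 n k = n.choose (2 * k) * (k + 1).choose 3 ∧
      r 1 n k = n.choose (2 * k + 1) * ((k + 2).choose 3 + (k + 1).choose 3) ∧
      r 2 n k = n.choose (2 * k + 2) * (k + 2).choose 3) ∧
    genFun rStar
      = y * x ^ 3 * (1 - x) ^ 2 * (1 - x + x * y) * (((1 - x) ^ 2 - y * x ^ 2) ^ 4)⁻¹ ∧
    genFun (r 0) = y ^ 2 * x ^ 4 * (1 - x) ^ 3 * (((1 - x) ^ 2 - y * x ^ 2) ^ 4)⁻¹ ∧
    genFun (r 1)
      = y * x ^ 3 * (1 - x) ^ 2 * ((1 - x) ^ 2 + y * x ^ 2)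
        * (((1 - x) ^ 2 - y * x ^ 2) ^ 4)⁻¹ ∧
    genFun (r 2) = y * x ^ 4 * (1 - x) ^ 3 * (((1 - x) ^ 2 - y * x ^ 2) ^ 4)⁻¹ :=
  ⟨rStar_formula, fun n k => ⟨r_zero n k, r_one n k, r_two n k⟩, genFun_rStar, genFun_r_zero,
    genFun_r_one, genFun_r_two⟩
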